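/- Let $(M,g)$ be a Riemannian manifold of dimension $n\ge 4$ with Ricci tensor $r$, scalar curvature $s$, traceless Ricci tensor $z=r-\frac sn g$ and Riemann tensor $R$, where $R(X,Y,X,Y)$ is the sectional curvature for orthonormal $X,Y$. The Weyl tensor $\mathcal W$ is defined by $R=\frac{s}{2n(n-1)}\,g\owedge g+\frac1{n-2}\,z\owedge g+\mathcal W$ (with $\owedge$ the Kulkarni--Nomizu product), and the Bach tensor by $$B(X,Y)=\frac1{n-3}\sum_{i,j}D_{E_i}D_{E_j}\mathcal W(X,E_i,Y,E_j)+\frac1{n-2}\sum_{i,j}\mathcal W(X,E_i,Y,E_j)\,r(E_i,E_j),$$ where $\{E_i\}$ is an orthonormal frame and $D$ denotes covariant differentiation. Put $$\mathrm{div}^2B=\sum_{i,j}D_{E_j}D_{E_i}B(E_i,E_j),\qquad \mathrm{div}^4\mathcal W=\sum_{i,j,k,l}D_{E_j}D_{E_l}D_{E_k}D_{E_i}\mathcal W(E_i,E_j,E_k,E_l).$$ A complete Riemannian manifold $(M^n,g)$ is called a vacuum static space if there is a smooth function $f\not\equiv0$ on $M$ with $$\Delta f=-\frac{s}{n-1}f,\qquad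 D\,df-\Big(r-\frac{s}{n-1}g\Big)f=0 .$$ Proposition. For every $n\ge4$ there is a connected $n$-dimensional vacuum static space with $\mathrm{div}^2B=0$ and $\mathrm{div}^4\mathcal W=0$ but $B\ne0$. More precisely, writing $S^m(c)$ for the round $m$-sphere of constant sectional curvature $c>0$, the following Riemannian products have these properties: (a) in dimension $2m$, $m\ge2$: $S^m\big(\tfrac{a}{kl}\big)\times S^m\big(\tfrac{a}{l}\big)$ for every $a>0$, where $k=\frac{m}{m-1}$ and $l=\frac{3m(m-1)}{2}$; (b) in dimension $2m+1$, $m\ge2$: the product $S^m\times S^{m+1}$ of unit spheres. -/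

import Mathlib

open scoped Manifold ContDiff Bundle

noncomputable section

namespace StaticSpace

/-! ### Tensor calculus of a metric on an open piece of a vector space

`G` is a field of symmetric positive definite bilinear forms on (an open subset of) the finite
dimensional vector space `E`. A covariant `k`-tensor field is `T : E → (Fin k → E) → ℝ`, where
`T x ![v₁, …, vₖ]` is the value at the point `x` on the (constant) vectors `v₁, …, vₖ`. -/

section Local

variable {E : Type*} [NormedAddCommGroup E] [NormedSpace ℝ E]

/-- A field of bilinear forms on `E`. -/
abbrev BilinField (E : Type*) [NormedAddCommGroup E] [NormedSpace ℝ E] :=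
  E → E →L[ℝ] E →L[ℝ] ℝ

/-- A covariant `k`-tensor field on `E`. -/
abbrev TensorField (E : Type*) (k : ℕ) := E → (Fin k → E) → ℝ

/-- The Christoffel symbols `Γ(u, v)` of the Levi-Civita connection: the vector with
`2 G(Γ(u, v), w) = ∂ᵤG(v, w) + ∂ᵥG(u, w) - ∂_wG(u, v)` for all `w`. -/
def christoffel (G : BilinField E) (x u v : E) : E :=
  (G x).inverse ((1 / 2 : ℝ) •
    (fderiv ℝ G x u v + fderiv ℝ G x v u - ((fderiv ℝ G x).flip u).flip v))

/-- The covariant derivative: `(DT)(u, v₁, …, vₖ) = (D_u T)(v₁, …, vₖ)`. The direction of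
differentiation is the first argument. -/
def covDeriv (G : BilinField E) {k : ℕ} (T : TensorField E k) : TensorField E (k + 1) :=
  fun x w =>
    fderiv ℝ (fun y => T y (Fin.tail w)) x (w 0)
      - ∑ i : Fin k,
          T x (Function.update (Fin.tail w) i (christoffel G x (w 0) (Fin.tail w i)))

/-- The trace with respect to `G x` of a bilinear form `b`, i.e. `∑ᵢⱼ Gⁱʲ b(eᵢ, eⱼ)` for a basis
`e` of `E` (the value does not depend on the basis; for a `G x`-orthonormal basis it is
`∑ᵢ b(eᵢ, eᵢ)`). The vector `(G x).inverse (eⁱ)` is `∑ⱼ Gⁱʲ eⱼ`, with `eⁱ` the dual basis. -/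
def metricTrace [FiniteDimensional ℝ E] (G : BilinField E) (x : E) (b : E → E → ℝ) : ℝ :=
  ∑ i, b (Module.finBasis ℝ E i)
    ((G x).inverse (LinearMap.toContinuousLinearMap ((Module.finBasis ℝ E).coord i)))

/-- The divergence of a tensor field in the slot `j` (slots are numbered from `0`):
`(div_j T)(v) = ∑ᵢ (D_{Eᵢ} T)(v₀, …, Eᵢ, …)`, with `Eᵢ` inserted in the slot `j` and `{Eᵢ}` an
orthonormal frame. -/
def divSlot [FiniteDimensional ℝ E] (G : BilinField E) {k : ℕ} (j : Fin (k + 1))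
    (T : TensorField E (k + 1)) : TensorField E k :=
  fun x v => metricTrace G x fun a b => covDeriv G T x (Fin.cons a (Fin.insertNth j b v))

/-- The curvature operator `R(u, v)w = D_u D_v w - D_v D_u w - D_{[u, v]} w`. -/
def curvOp (G : BilinField E) (x u v w : E) : E :=
  fderiv ℝ (fun y => christoffel G y v w) x u - fderiv ℝ (fun y => christoffel G y u w) x v
    + christoffel G x u (christoffel G x v w) - christoffel G x v (christoffel G x u w)

/-- The Riemann curvature tensor, with the sign for which `Rm(u, v, u, v)` is the sectional
curvature of the plane spanned by orthonormal `u`, `v`. -/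
def riem (G : BilinField E) : TensorField E 4 :=
  fun x v => G x (curvOp G x (v 0) (v 1) (v 3)) (v 2)

variable [FiniteDimensional ℝ E]

/-- The Ricci tensor `r`. -/
def ricci (G : BilinField E) : TensorField E 2 :=
  fun x v => metricTrace G x fun a b => riem G x ![v 0, a, v 1, b]

/-- The scalar curvature `s`. -/
def scal (G : BilinField E) (x : E) : ℝ :=
  metricTrace G x fun a b => ricci G x ![a, b]

/-- The traceless Ricci tensor `z = r - (s / n) g`. -/
def tracelessRicci (G : BilinField E) : TensorField E 2 :=
  fun x v => ricci G x v - scal G x / (Module.finrank ℝ E : ℝ) * G x (v 0) (v 1)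

/-- The metric as a 2-tensor. -/
def metricTensor (G : BilinField E) : TensorField E 2 :=
  fun x v => G x (v 0) (v 1)

/-- The Kulkarni-Nomizu product of two symmetric 2-tensors. -/
def kulkarniNomizu (h k : TensorField E 2) : TensorField E 4 :=
  fun x v =>
    h x ![v 0, v 2] * k x ![v 1, v 3] + h x ![v 1, v 3] * k x ![v 0, v 2]
      - h x ![v 0, v 3] * k x ![v 1, v 2] - h x ![v 1, v 2] * k x ![v 0, v 3]

/-- The Weyl tensor `W`, from
`Rm = s / (2n(n-1)) g ∧ g + 1 / (n-2) z ∧ g + W` (`∧` the Kulkarni-Nomizu product). -/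
def weyl (G : BilinField E) : TensorField E 4 :=
  fun x v =>
    riem G x v
      - scal G x / (2 * (Module.finrank ℝ E : ℝ) * ((Module.finrank ℝ E : ℝ) - 1))
          * kulkarniNomizu (metricTensor G) (metricTensor G) x v
      - 1 / ((Module.finrank ℝ E : ℝ) - 2)
          * kulkarniNomizu (tracelessRicci G) (metricTensor G) x v

/-- `W̊r(X, Y) = ∑ᵢ r(W(X, Eᵢ)Y, Eᵢ) = ∑ᵢⱼ W(X, Eᵢ, Y, Eⱼ) r(Eᵢ, Eⱼ)` for an orthonormal
frame `{Eᵢ}`. -/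
def weylRicci (G : BilinField E) : TensorField E 2 :=
  fun x v =>
    metricTrace G x fun a a' => metricTrace G x fun b b' =>
      weyl G x ![v 0, a, v 1, b] * ricci G x ![a', b']

/-- The Bach tensor
`B(X, Y) = 1 / (n-3) ∑ᵢⱼ D_{Eᵢ} D_{Eⱼ} W(X, Eᵢ, Y, Eⱼ) + 1 / (n-2) W̊r(X, Y)`. -/
def bach (G : BilinField E) : TensorField E 2 :=
  fun x v =>
    1 / ((Module.finrank ℝ E : ℝ) - 3) * divSlot G 1 (divSlot G 3 (weyl G)) x v
      + 1 / ((Module.finrank ℝ E : ℝ) - 2) * weylRicci G x v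

/-- The complete divergence `div² B = ∑ᵢⱼ D_{Eⱼ} D_{Eᵢ} B(Eᵢ, Eⱼ)` of the Bach tensor. -/
def div2Bach (G : BilinField E) (x : E) : ℝ :=
  divSlot G 0 (divSlot G 0 (bach G)) x ![]

/-- The complete divergence
`div⁴ W = ∑ D_{Eⱼ} D_{Eₗ} D_{Eₖ} D_{Eᵢ} W(Eᵢ, Eⱼ, Eₖ, Eₗ)` of the Weyl tensor. After the first
divergence `(div W)(Y, Z, U) = ∑ᵢ D_{Eᵢ} W(Eᵢ, Y, Z, U)`, which is a multiple of the Cotton tensor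
`C(Z, U, Y)`, the arguments of `C` are contracted in the order `Z`, `U`, `Y`. -/
def div4Weyl (G : BilinField E) (x : E) : ℝ :=
  divSlot G 0 (divSlot G 1 (divSlot G 1 (divSlot G 0 (weyl G)))) x ![]

/-- The Hessian `Ddf` of a function. -/
def hessian (G : BilinField E) (f : E → ℝ) : TensorField E 2 :=
  covDeriv G (covDeriv G (k := 0) fun x _ => f x)

/-- The Laplacian `Δf = tr Ddf`. -/
def laplacian (G : BilinField E) (f : E → ℝ) (x : E) : ℝ :=
  metricTrace G x fun a b => hessian G f x ![a, b]

end Local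

/-! ### Riemannian manifolds

At a point `x` of the manifold every tensor is computed in the preferred chart at `x`; the tangent
space at `x` is identified with the model vector space `E` by this chart. -/

section Global

variable {E : Type*} [NormedAddCommGroup E] [NormedSpace ℝ E]
  {H : Type*} [TopologicalSpace H] {I : ModelWithCorners ℝ E H}
  {M : Type*} [TopologicalSpace M] [ChartedSpace H M] [IsManifold I ∞ M]

/-- Smooth Riemannian metrics on `M`. -/
abbrev RMetric (I : ModelWithCorners ℝ E H) (M : Type*) [TopologicalSpace M] [ChartedSpace H M]
    [IsManifold I ∞ M] :=
  Bundle.ContMDiffRiemannianMetric I ∞ E (fun x : M => TangentSpace I x)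

/-- The metric `g` read in the preferred chart `φ` at `x₀`: the pullback of `g` by `φ⁻¹`. -/
def chartMetric (g : RMetric I M) (x₀ : M) : BilinField E := fun y =>
  ContinuousLinearMap.bilinearComp (E := E) (F := E)
    (g.inner ((extChartAt I x₀).symm y))
    (mfderiv 𝓘(ℝ, E) I (extChartAt I x₀).symm y)
    (mfderiv 𝓘(ℝ, E) I (extChartAt I x₀).symm y)

/-- Completeness of the Riemannian distance: every Cauchy sequence converges. -/
def IsComplete (g : RMetric I M) : Prop :=
  letI : Bundle.RiemannianBundle (fun x : M => TangentSpace I x) := ⟨g.toRiemannianMetric⟩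
  ∀ u : ℕ → M,
    (∀ ε > 0, ∃ N, ∀ i ≥ N, ∀ j ≥ N, Manifold.riemannianEDist I (u i) (u j) < ε) →
      ∃ x, Filter.Tendsto u Filter.atTop (nhds x)

variable [FiniteDimensional ℝ E]

/-- The function `f` is a solution of the vacuum static equations
`Δf = - s / (n-1) f` and `Ddf - (r - s / (n-1) g) f = 0`. -/
def SolvesVacuumStatic (g : RMetric I M) (f : M → ℝ) : Prop :=
  ∀ x : M,
    let G := chartMetric g x
    let F : E → ℝ := f ∘ (extChartAt I x).symm
    let y := extChartAt I x x
    let n : ℝ := Module.finrank ℝ E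
    laplacian G F y = - (scal G y / (n - 1)) * f x ∧
      ∀ u v : E,
        hessian G F y ![u, v] - (ricci G y ![u, v] - scal G y / (n - 1) * G y u v) * f x = 0

/-- `(M, g)` is a vacuum static space: it is complete and the vacuum static equations have a
smooth solution that is not identically zero. -/
def IsVacuumStatic (g : RMetric I M) : Prop :=
  IsComplete g ∧
    ∃ f : M → ℝ, ContMDiff I 𝓘(ℝ, ℝ) ∞ f ∧ (∃ x, f x ≠ 0) ∧ SolvesVacuumStatic g f

/-- The Bach tensor at `x`, a bilinear form on the tangent space at `x`. -/
def bachAt (g : RMetric I M) (x : M) (u v : TangentSpace I x) : ℝ :=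
  bach (E := E) (chartMetric g x) (extChartAt I x x) ![u, v]

/-- The Bach tensor vanishes identically. -/
def IsBachFlat (g : RMetric I M) : Prop :=
  ∀ (x : M) (u v : TangentSpace I x), bachAt g x u v = 0

/-- `div² B = 0` on `M`. -/
def Div2BachVanishes (g : RMetric I M) : Prop :=
  ∀ x : M, div2Bach (chartMetric g x) (extChartAt I x x) = 0

/-- `div⁴ W = 0` on `M`. -/
def Div4WeylVanishes (g : RMetric I M) : Prop :=
  ∀ x : M, div4Weyl (chartMetric g x) (extChartAt I x x) = 0

/-- A vacuum static space with `div² B = 0`, `div⁴ W = 0` and `B ≠ 0`. -/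
def IsExample (g : RMetric I M) : Prop :=
  IsVacuumStatic g ∧ Div2BachVanishes g ∧ Div4WeylVanishes g ∧ ¬ IsBachFlat g

end Global

/-! ### Products of round spheres -/

/-- The unit sphere `S^p` in `ℝ^(p+1)`. -/
abbrev Sph (p : ℕ) : Type := Metric.sphere (0 : EuclideanSpace ℝ (Fin (p + 1))) 1

/-- A tangent vector of the sphere, as a vector of the ambient Euclidean space. -/
def ambientVec {p : ℕ} (x : Sph p) (u : TangentSpace (𝓡 p) x) : EuclideanSpace ℝ (Fin (p + 1)) :=
  mfderiv (𝓡 p) 𝓘(ℝ, EuclideanSpace ℝ (Fin (p + 1)))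
    (fun z : Sph p => (z : EuclideanSpace ℝ (Fin (p + 1)))) x u

/-- The round metric of the unit sphere `S^p`: the restriction of the Euclidean inner product. -/
def roundInner {p : ℕ} (x : Sph p) (u v : TangentSpace (𝓡 p) x) : ℝ :=
  inner ℝ (ambientVec x u) (ambientVec x v)

/-- `g` is the product metric of `S^p(c₁) × S^q(c₂)`, where `S^p(c)` is the round sphere of
constant sectional curvature `c > 0`, i.e. of radius `1 / √c`, written as the unit sphere with its
metric multiplied by `1 / c`. -/
def IsRoundProduct {p q : ℕ} (c₁ c₂ : ℝ) (g : RMetric ((𝓡 p).prod (𝓡 q)) (Sph p × Sph q)) : Prop :=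
  ∀ (x : Sph p × Sph q) (u v : TangentSpace ((𝓡 p).prod (𝓡 q)) x),
    g.inner x u v
      = 1 / c₁ * roundInner x.1 (Prod.fst u) (Prod.fst v)
        + 1 / c₂ * roundInner x.2 (Prod.snd u) (Prod.snd v)

end StaticSpace

end

/-!
On a product of two spaces of constant curvatures `c₁`, `c₂`, of dimensions `d₁`, `d₂`, the Riemann
tensor is a combination of Kulkarni–Nomizu products of the metrics `g₁`, `g₂` of the factors, which
are parallel. Hence the Weyl and Bach tensors are parallel, all their divergences vanish, and the
Bach tensor is a multiple of `d₂ g₁ - d₁ g₂`, non-zero unless `c₁ + c₂ = 0`, a factor is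
one-dimensional, or the product is Einstein. If moreover the second factor has Ricci curvature
`(d₂ - 1) c₂ = d₁ c₁`, which is then `s / (n - 1)`, the static equations for a function of the first
factor reduce to Obata's equation `D df = -c₁ f g₁`, solved on the sphere by the linear functions.
-/

noncomputable section

namespace StaticSpace

section Parallel

variable {E : Type*} [NormedAddCommGroup E] [NormedSpace ℝ E] {G : BilinField E} {k : ℕ}

/-- Parallel tensor fields. Differentiability is required because `covDeriv` is computed with the
junk value `0` of `fderiv` where the field is not differentiable. -/
structure IsParallel (G : BilinField E) (T : TensorField E k) : Prop where
  differentiable : ∀ v, Differentiable ℝ fun y => T y v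
  covDeriv_eq_zero : covDeriv G T = 0

lemma isParallel_iff {T : TensorField E k} :
    IsParallel G T ↔ (∀ v, Differentiable ℝ fun y => T y v) ∧ ∀ x u v,
      fderiv ℝ (fun y => T y v) x u =
        ∑ i, T x (Function.update v i (christoffel G x u (v i))) := by
  refine ⟨fun h => ⟨h.differentiable, fun x u v => ?_⟩, fun h => ⟨h.1, ?_⟩⟩
  · simpa [covDeriv, sub_eq_zero] using
      congrFun (congrFun h.covDeriv_eq_zero x) (Fin.cons u v : Fin (k + 1) → E)
  · funext x w
    exact sub_eq_zero.2 (h.2 x (w 0) (Fin.tail w))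

namespace IsParallel

variable {S T : TensorField E k}

lemma fderiv_apply (hT : IsParallel G T) (x u : E) (v : Fin k → E) :
    fderiv ℝ (fun y => T y v) x u =
      ∑ i, T x (Function.update v i (christoffel G x u (v i))) :=
  (isParallel_iff.1 hT).2 x u v

lemma zero : IsParallel G (0 : TensorField E k) :=
  isParallel_iff.2 ⟨fun _ => differentiable_const 0, by simp⟩

lemma add (hS : IsParallel G S) (hT : IsParallel G T) : IsParallel G (S + T) := by
  refine isParallel_iff.2 ⟨fun v => (hS.differentiable v).add (hT.differentiable v),
    fun x u v => ?_⟩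
  simp only [Pi.add_apply, Finset.sum_add_distrib, ← hS.fderiv_apply, ← hT.fderiv_apply]
  rw [fderiv_fun_add (hS.differentiable v x) (hT.differentiable v x), add_apply]

lemma const_smul (hT : IsParallel G T) (c : ℝ) : IsParallel G (c • T) := by
  refine isParallel_iff.2 ⟨fun v => (hT.differentiable v).const_smul c, fun x u v => ?_⟩
  simp only [Pi.smul_apply, ← Finset.smul_sum, ← hT.fderiv_apply]
  rw [fderiv_fun_const_smul (hT.differentiable v x), smul_apply]

lemma sub (hS : IsParallel G S) (hT : IsParallel G T) : IsParallel G (S - T) := by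
  simpa [sub_eq_add_neg] using hS.add (hT.const_smul (-1))

lemma mul_comp {m n : ℕ} {S : TensorField E m} {T : TensorField E n} (hS : IsParallel G S)
    (hT : IsParallel G T) {f : Fin m → Fin k} {g : Fin n → Fin k}
    (hfg : Function.Bijective (Sum.elim f g)) :
    IsParallel G fun x v => S x (v ∘ f) * T x (v ∘ g) := by
  refine isParallel_iff.2
    ⟨fun v => (hS.differentiable _).mul (hT.differentiable _), fun x u v => ?_⟩
  have hf : f.Injective := hfg.1.comp Sum.inl_injective
  have hg : g.Injective := hfg.1.comp Sum.inr_injective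
  have hne : ∀ i j, f i ≠ g j := fun i j h => Sum.inl_ne_inr (hfg.1 (a₁ := .inl i) (a₂ := .inr j) h)
  rw [fderiv_fun_mul (hS.differentiable _ x) (hT.differentiable _ x),
    ← (Equiv.ofBijective _ hfg).sum_comp, Fintype.sum_sum_type]
  simp only [add_apply, smul_apply, smul_eq_mul, Equiv.ofBijective_apply, Sum.elim_inl,
    Sum.elim_inr, Function.update_comp_eq_of_injective _ hf,
    Function.update_comp_eq_of_injective _ hg,
    Function.update_comp_eq_of_forall_ne _ _ fun j => hne j _,
    Function.update_comp_eq_of_forall_ne _ _ fun i => (hne _ i).symm,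
    ← Finset.sum_mul, ← Finset.mul_sum, hS.fderiv_apply, hT.fderiv_apply, Function.comp_apply]
  ring

lemma kulkarniNomizu {h k : TensorField E 2} (hh : IsParallel G h) (hk : IsParallel G k) :
    IsParallel G (kulkarniNomizu h k) := by
  have comp_pair (v : Fin 4 → E) (i j : Fin 4) : v ∘ ![i, j] = ![v i, v j] := by
    ext t; fin_cases t <;> rfl
  have key (i j l m : Fin 4) (hb : (Sum.elim ![i, j] ![l, m]).Bijective) : IsParallel G
      fun x (v : Fin 4 → E) => h x ![v i, v j] * k x ![v l, v m] := by
    simpa only [comp_pair] using hh.mul_comp hk hb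
  exact (((key 0 2 1 3 (by decide)).add (key 1 3 0 2 (by decide))).sub
    (key 0 3 1 2 (by decide))).sub (key 1 2 0 3 (by decide))

variable [FiniteDimensional ℝ E]

lemma divSlot_eq_zero {T : TensorField E (k + 1)} (hT : IsParallel G T) (j : Fin (k + 1)) :
    divSlot G j T = 0 := by
  funext x v
  simp [divSlot, hT.covDeriv_eq_zero, metricTrace]

end IsParallel

variable [FiniteDimensional ℝ E]

lemma divSlot_zero (j : Fin (k + 1)) : divSlot G j 0 = 0 :=
  IsParallel.zero.divSlot_eq_zero j

lemma div4Weyl_eq_zero (hW : IsParallel G (weyl G)) (x : E) : div4Weyl G x = 0 := by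
  simp only [div4Weyl, hW.divSlot_eq_zero, divSlot_zero, Pi.zero_apply]

lemma div2Bach_eq_zero (hB : IsParallel G (bach G)) (x : E) : div2Bach G x = 0 := by
  simp only [div2Bach, hB.divSlot_eq_zero, divSlot_zero, Pi.zero_apply]

lemma bach_eq_smul_weylRicci (hW : IsParallel G (weyl G)) :
    bach G = (1 / ((Module.finrank ℝ E : ℝ) - 2)) • weylRicci G := by
  funext x v
  simp [bach, hW.divSlot_eq_zero, divSlot_zero]

end Parallel

section PseudoRiemannian

variable {E : Type*} [NormedAddCommGroup E] [NormedSpace ℝ E] {G : BilinField E}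

/-- Smooth pseudo-Riemannian metrics on a vector space: nondegenerate symmetric bilinear forms
depending smoothly on the point. -/
structure IsPseudoRiemannian (G : BilinField E) : Prop where
  contDiff : ContDiff ℝ ∞ G
  symm : ∀ x u v, G x u v = G x v u
  isInvertible : ∀ x, (G x).IsInvertible

namespace IsPseudoRiemannian

lemma differentiable (hG : IsPseudoRiemannian G) : Differentiable ℝ G :=
  hG.contDiff.differentiable (by simp)

lemma fderiv_apply (hG : IsPseudoRiemannian G) (x u v w : E) :
    fderiv ℝ G x u v w = fderiv ℝ (fun y => G y v w) x u := by
  have h := ((hG.differentiable x).hasFDerivAt.clm_apply (hasFDerivAt_const v x)).clm_apply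
    (hasFDerivAt_const w x)
  simp [h.fderiv]

lemma fderiv_symm (hG : IsPseudoRiemannian G) (x u v w : E) :
    fderiv ℝ G x u v w = fderiv ℝ G x u w v := by
  simp only [hG.fderiv_apply, hG.symm _ v w]

lemma christoffel_eq_iff (hG : IsPseudoRiemannian G) {x u v z : E} :
    christoffel G x u v = z ↔ ∀ w, 2 * G x z w =
      fderiv ℝ G x u v w + fderiv ℝ G x v u w - fderiv ℝ G x w u v := by
  rw [christoffel, (hG.isInvertible x).inverse_apply_eq, ContinuousLinearMap.ext_iff]
  refine forall_congr' fun w => ?_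
  simp only [smul_apply, add_apply, sub_apply, ContinuousLinearMap.flip_apply, smul_eq_mul]
  constructor <;> intro h <;> linarith

lemma two_mul_apply_christoffel (hG : IsPseudoRiemannian G) (x u v w : E) :
    2 * G x (christoffel G x u v) w =
      fderiv ℝ G x u v w + fderiv ℝ G x v u w - fderiv ℝ G x w u v :=
  hG.christoffel_eq_iff.1 rfl w

lemma christoffel_zero_right (hG : IsPseudoRiemannian G) (x u : E) : christoffel G x u 0 = 0 :=
  hG.christoffel_eq_iff.2 fun w => by
    simp only [hG.fderiv_apply]
    simp

lemma fderiv_eq_add_christoffel (hG : IsPseudoRiemannian G) (x u v w : E) :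
    fderiv ℝ G x u v w = G x (christoffel G x u v) w + G x v (christoffel G x u w) := by
  rw [hG.symm x v]
  linarith [hG.two_mul_apply_christoffel x u v w, hG.two_mul_apply_christoffel x u w v,
    hG.fderiv_symm x u v w, hG.fderiv_symm x v u w, hG.fderiv_symm x w u v]

set_option maxSynthPendingDepth 3 in
lemma differentiable_christoffel [CompleteSpace E] (hG : IsPseudoRiemannian G) (u v : E) :
    Differentiable ℝ fun y => christoffel G y u v := by
  have hd : Differentiable ℝ (fderiv ℝ G) :=
    (hG.contDiff.fderiv_right (m := 1) (by norm_cast)).differentiable one_ne_zero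
  have hinv : Differentiable ℝ fun y => (G y).inverse := fun y =>
    (((hG.isInvertible y).contDiffAt_map_inverse (n := 1)).differentiableAt one_ne_zero).comp y
      (hG.differentiable y)
  have hflip : Differentiable ℝ fun y => ((fderiv ℝ G y).flip u).flip v :=
    ((ContinuousLinearMap.flipₗᵢ ℝ E E ℝ).differentiable.comp
      (((ContinuousLinearMap.flipₗᵢ ℝ E E (E →L[ℝ] ℝ)).differentiable.comp hd).clm_apply
        (differentiable_const u))).clm_apply (differentiable_const v)
  unfold christoffel
  exact hinv.clm_apply (by fun_prop)

end IsPseudoRiemannian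

/-- The tensor `g(A ·, ·)` obtained by lowering an index of a constant endomorphism `A`. -/
def lower (G : BilinField E) (A : Module.End ℝ E) : TensorField E 2 :=
  fun x v => G x (A (v 0)) (v 1)

lemma lower_apply (A : Module.End ℝ E) (x u v : E) : lower G A x ![u, v] = G x (A u) v := rfl

lemma lower_one : lower G 1 = metricTensor G := rfl

lemma lower_add (A B : Module.End ℝ E) : lower G (A + B) = lower G A + lower G B := by
  funext x v
  simp [lower]

lemma lower_sub (A B : Module.End ℝ E) : lower G (A - B) = lower G A - lower G B := by
  funext x v
  simp [lower]

lemma lower_smul (c : ℝ) (A : Module.End ℝ E) : lower G (c • A) = c • lower G A := by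
  funext x v
  simp [lower]

lemma isParallel_lower (hG : IsPseudoRiemannian G) {A : Module.End ℝ E}
    (hA : ∀ x u v, christoffel G x u (A v) = A (christoffel G x u v)) :
    IsParallel G (lower G A) := by
  refine isParallel_iff.2 ⟨fun v => ?_, fun x u v => ?_⟩
  · exact (hG.differentiable.clm_apply (differentiable_const _)).clm_apply (differentiable_const _)
  · have h := hG.fderiv_apply x u (A (v 0)) (v 1)
    simp [lower, ← h, hG.fderiv_eq_add_christoffel, hA]

section Trace

variable [FiniteDimensional ℝ E]

lemma metricTrace_add (x : E) (b b' : E → E → ℝ) :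
    metricTrace G x (fun u v => b u v + b' u v) = metricTrace G x b + metricTrace G x b' :=
  Finset.sum_add_distrib

lemma metricTrace_sub (x : E) (b b' : E → E → ℝ) :
    metricTrace G x (fun u v => b u v - b' u v) = metricTrace G x b - metricTrace G x b' :=
  Finset.sum_sub_distrib _ _

lemma metricTrace_const_mul (x : E) (c : ℝ) (b : E → E → ℝ) :
    metricTrace G x (fun u v => c * b u v) = c * metricTrace G x b :=
  (Finset.mul_sum _ _ _).symm

lemma metricTrace_mul_const (x : E) (c : ℝ) (b : E → E → ℝ) :
    metricTrace G x (fun u v => b u v * c) = metricTrace G x b * c :=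
  (Finset.sum_mul _ _ _).symm

namespace IsPseudoRiemannian

lemma metricTrace_mul_apply (hG : IsPseudoRiemannian G) (x w : E) {l : E → ℝ}
    (hl : IsLinearMap ℝ l) : metricTrace G x (fun a b => l a * G x w b) = l w := by
  conv_rhs => rw [← (Module.finBasis ℝ E).sum_repr w, ← hl.mk'_apply, map_sum]
  refine Finset.sum_congr rfl fun i _ => ?_
  beta_reduce
  rw [hG.symm, (hG.isInvertible x).self_apply_inverse]
  simp [mul_comm]

lemma metricTrace_lower (hG : IsPseudoRiemannian G) (A : Module.End ℝ E) (x : E) :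
    metricTrace G x (fun a b => lower G A x ![a, b]) = LinearMap.trace ℝ E A := by
  rw [LinearMap.trace_eq_matrix_trace ℝ (Module.finBasis ℝ E), Matrix.trace]
  refine Finset.sum_congr rfl fun i _ => ?_
  beta_reduce
  rw [lower_apply, hG.symm, (hG.isInvertible x).self_apply_inverse]
  simp [LinearMap.toMatrix_apply]

end IsPseudoRiemannian

/-- The trace of `T(X, ·, Y, C ·)`, for a constant endomorphism `C`. For `C = 1` this contraction
takes the Riemann tensor to the Ricci tensor; for `C` the Ricci endomorphism it takes the Weyl
tensor to the term `W̊r` of the Bach tensor. -/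
def contract (G : BilinField E) (C : Module.End ℝ E) (T : TensorField E 4) : TensorField E 2 :=
  fun x v => metricTrace G x fun a b => T x ![v 0, a, v 1, C b]

lemma ricci_eq_contract : ricci G = contract G 1 (riem G) := rfl

lemma contract_add (C : Module.End ℝ E) (S T : TensorField E 4) :
    contract G C (S + T) = contract G C S + contract G C T := by
  funext x v
  exact metricTrace_add x _ _

lemma contract_sub (C : Module.End ℝ E) (S T : TensorField E 4) :
    contract G C (S - T) = contract G C S - contract G C T := by
  funext x v
  exact metricTrace_sub x _ _

lemma contract_smul (C : Module.End ℝ E) (c : ℝ) (T : TensorField E 4) :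
    contract G C (c • T) = c • contract G C T := by
  funext x v
  exact metricTrace_const_mul x c _

namespace IsPseudoRiemannian

lemma weylRicci_eq_contract (hG : IsPseudoRiemannian G) {C : Module.End ℝ E}
    (hr : ricci G = lower G C)
    (hW : ∀ x u a v, IsLinearMap ℝ fun b => weyl G x ![u, a, v, b]) :
    weylRicci G = contract G C (weyl G) := by
  funext x v
  simp only [weylRicci, hr, lower_apply, hG.metricTrace_mul_apply _ _ (hW x _ _ _), contract]

lemma contract_kulkarniNomizu_lower (hG : IsPseudoRiemannian G) {C : Module.End ℝ E}
    (hC : ∀ x u v, G x u (C v) = G x (C u) v) (A B : Module.End ℝ E) :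
    contract G C (kulkarniNomizu (lower G A) (lower G B)) =
      lower G (LinearMap.trace ℝ E (C * B) • A + LinearMap.trace ℝ E (C * A) • B
        - B * C * A - A * C * B) := by
  have htrace (A : Module.End ℝ E) (x : E) :
      metricTrace G x (fun a b => G x (A a) (C b)) = LinearMap.trace ℝ E (C * A) := by
    simp only [hC]
    exact hG.metricTrace_lower (C * A) x
  have hmul (A B : Module.End ℝ E) (x u v : E) :
      metricTrace G x (fun a b => G x (A a) v * G x (B u) (C b)) = G x ((A * C * B) u) v := by
    simp only [hC]
    exact hG.metricTrace_mul_apply x (C (B u)) ⟨by simp, by simp⟩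
  have hmul' (A B : Module.End ℝ E) (x u v : E) :
      metricTrace G x (fun a b => G x (B u) (C b) * G x (A a) v) = G x ((A * C * B) u) v := by
    simp only [mul_comm (G x (B u) _), hmul]
  funext x v
  simp only [contract, kulkarniNomizu, lower, Matrix.cons_val, metricTrace_add, metricTrace_sub,
    metricTrace_const_mul, metricTrace_mul_const, hmul, hmul', htrace, LinearMap.sub_apply,
    LinearMap.add_apply, LinearMap.smul_apply, map_sub, map_add, map_smul, sub_apply, add_apply,
    smul_apply, smul_eq_mul]
  ring

end IsPseudoRiemannian

end Trace

end PseudoRiemannian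

section Product

variable {V W : Type*} [NormedAddCommGroup V] [NormedSpace ℝ V]
  [NormedAddCommGroup W] [NormedSpace ℝ W] {G₁ : BilinField V} {G₂ : BilinField W}

/-- The product metric `g₁ ⊕ g₂`. -/
def prodMetric (G₁ : BilinField V) (G₂ : BilinField W) : BilinField (V × W) := fun x =>
  (G₁ x.1).bilinearComp (.fst ℝ V W) (.fst ℝ V W) +
    (G₂ x.2).bilinearComp (.snd ℝ V W) (.snd ℝ V W)

lemma prodMetric_apply (x u v : V × W) :
    prodMetric G₁ G₂ x u v = G₁ x.1 u.1 v.1 + G₂ x.2 u.2 v.2 := rfl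

lemma contDiff_bilinearComp {E F : Type*} [NormedAddCommGroup E] [NormedSpace ℝ E]
    [NormedAddCommGroup F] [NormedSpace ℝ F] {n : WithTop ℕ∞} {G : BilinField F}
    (hG : ContDiff ℝ n G) (L : E →L[ℝ] F) :
    ContDiff ℝ n fun x : E => (G (L x)).bilinearComp L L :=
  show ContDiff ℝ n fun x : E => (L.precomp ℝ).comp ((G (L x)).comp L) from
  (contDiff_const (c := L.precomp ℝ)).clm_comp
    ((hG.comp L.contDiff).clm_comp (contDiff_const (c := L)))

lemma isInvertible_prodMetric (h₁ : IsPseudoRiemannian G₁) (h₂ : IsPseudoRiemannian G₂)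
    (x : V × W) : (prodMetric G₁ G₂ x).IsInvertible := by
  obtain ⟨e₁, h₁⟩ := h₁.isInvertible x.1
  obtain ⟨e₂, h₂⟩ := h₂.isInvertible x.2
  refine ⟨(e₁.prodCongr e₂).trans (ContinuousLinearMap.coprodEquivL ℝ), ?_⟩
  ext u v <;> simp [prodMetric, ← h₁, ← h₂]

lemma IsPseudoRiemannian.prodMetric (h₁ : IsPseudoRiemannian G₁) (h₂ : IsPseudoRiemannian G₂) :
    IsPseudoRiemannian (prodMetric G₁ G₂) where
  contDiff := (contDiff_bilinearComp h₁.contDiff (.fst ℝ V W)).add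
    (contDiff_bilinearComp h₂.contDiff (.snd ℝ V W))
  symm x u v := by simp only [prodMetric_apply, h₁.symm x.1 u.1, h₂.symm x.2 u.2]
  isInvertible := isInvertible_prodMetric h₁ h₂

lemma fderiv_comp_fst {F : Type*} [NormedAddCommGroup F] [NormedSpace ℝ F] {f : V → F} {x : V × W}
    (hf : DifferentiableAt ℝ f x.1) (u : V × W) :
    fderiv ℝ (fun y : V × W => f y.1) x u = fderiv ℝ f x.1 u.1 := by
  have h : HasFDerivAt (fun y : V × W => f y.1) _ x := hf.hasFDerivAt.comp x hasFDerivAt_fst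
  rw [h.fderiv]
  rfl

lemma fderiv_comp_snd {F : Type*} [NormedAddCommGroup F] [NormedSpace ℝ F] {f : W → F} {x : V × W}
    (hf : DifferentiableAt ℝ f x.2) (u : V × W) :
    fderiv ℝ (fun y : V × W => f y.2) x u = fderiv ℝ f x.2 u.2 := by
  have h : HasFDerivAt (fun y : V × W => f y.2) _ x := hf.hasFDerivAt.comp x hasFDerivAt_snd
  rw [h.fderiv]
  rfl

lemma fderiv_prodMetric (h₁ : IsPseudoRiemannian G₁) (h₂ : IsPseudoRiemannian G₂)
    (x u v w : V × W) : fderiv ℝ (prodMetric G₁ G₂) x u v w =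
      fderiv ℝ G₁ x.1 u.1 v.1 w.1 + fderiv ℝ G₂ x.2 u.2 v.2 w.2 := by
  have hd₁ := (h₁.differentiable.clm_apply (differentiable_const v.1)).clm_apply
    (differentiable_const w.1)
  have hd₂ := (h₂.differentiable.clm_apply (differentiable_const v.2)).clm_apply
    (differentiable_const w.2)
  rw [(h₁.prodMetric h₂).fderiv_apply, h₁.fderiv_apply, h₂.fderiv_apply,
    ← fderiv_comp_fst (hd₁ x.1), ← fderiv_comp_snd (hd₂ x.2)]
  exact congrArg (· u) (fderiv_fun_add ((hd₁ x.1).comp x differentiableAt_fst)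
    ((hd₂ x.2).comp x differentiableAt_snd))

lemma christoffel_prodMetric (h₁ : IsPseudoRiemannian G₁) (h₂ : IsPseudoRiemannian G₂)
    (x u v : V × W) : christoffel (prodMetric G₁ G₂) x u v =
      (christoffel G₁ x.1 u.1 v.1, christoffel G₂ x.2 u.2 v.2) := by
  refine (h₁.prodMetric h₂).christoffel_eq_iff.2 fun w => ?_
  simp only [fderiv_prodMetric h₁ h₂, prodMetric_apply]
  linear_combination h₁.two_mul_apply_christoffel x.1 u.1 v.1 w.1 +
    h₂.two_mul_apply_christoffel x.2 u.2 v.2 w.2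

lemma curvOp_prodMetric [CompleteSpace V] [CompleteSpace W] (h₁ : IsPseudoRiemannian G₁)
    (h₂ : IsPseudoRiemannian G₂) (x u v w : V × W) : curvOp (prodMetric G₁ G₂) x u v w =
      (curvOp G₁ x.1 u.1 v.1 w.1, curvOp G₂ x.2 u.2 v.2 w.2) := by
  have hfderiv (u v w : V × W) :
      fderiv ℝ (fun y : V × W => (christoffel G₁ y.1 v.1 w.1, christoffel G₂ y.2 v.2 w.2)) x u =
        (fderiv ℝ (fun y => christoffel G₁ y v.1 w.1) x.1 u.1,
          fderiv ℝ (fun y => christoffel G₂ y v.2 w.2) x.2 u.2) := by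
    have h := ((h₁.differentiable_christoffel v.1 w.1 x.1).hasFDerivAt.comp x
      hasFDerivAt_fst).prodMk ((h₂.differentiable_christoffel v.2 w.2 x.2).hasFDerivAt.comp x
      hasFDerivAt_snd)
    exact DFunLike.congr_fun h.fderiv u
  simp only [curvOp, christoffel_prodMetric h₁ h₂, hfderiv, Prod.mk_add_mk, Prod.mk_sub_mk]

lemma riem_prodMetric [CompleteSpace V] [CompleteSpace W] (h₁ : IsPseudoRiemannian G₁)
    (h₂ : IsPseudoRiemannian G₂) (x : V × W) (v : Fin 4 → V × W) :
    riem (prodMetric G₁ G₂) x v =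
      riem G₁ x.1 (fun i => (v i).1) + riem G₂ x.2 (fun i => (v i).2) := by
  simp only [riem, prodMetric_apply, curvOp_prodMetric h₁ h₂]

variable (V W) in
/-- The projection of `V × W` onto the first factor, as an endomorphism. -/
def fstProj : Module.End ℝ (V × W) := LinearMap.prodMap 1 0

variable (V W) in
/-- The projection of `V × W` onto the second factor, as an endomorphism. -/
def sndProj : Module.End ℝ (V × W) := LinearMap.prodMap 0 1

lemma fstProj_add_sndProj : fstProj V W + sndProj V W = 1 := by
  ext <;> simp [fstProj, sndProj]

lemma fstProj_mul_fstProj : fstProj V W * fstProj V W = fstProj V W := by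
  ext <;> simp [fstProj]

lemma fstProj_mul_sndProj : fstProj V W * sndProj V W = 0 := by
  ext <;> simp [fstProj, sndProj]

lemma sndProj_mul_fstProj : sndProj V W * fstProj V W = 0 := by
  ext <;> simp [fstProj, sndProj]

lemma sndProj_mul_sndProj : sndProj V W * sndProj V W = sndProj V W := by
  ext <;> simp [sndProj]

lemma trace_fstProj [FiniteDimensional ℝ V] [FiniteDimensional ℝ W] :
    LinearMap.trace ℝ (V × W) (fstProj V W) = Module.finrank ℝ V := by
  simp [fstProj, LinearMap.trace_prodMap']

lemma trace_sndProj [FiniteDimensional ℝ V] [FiniteDimensional ℝ W] :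
    LinearMap.trace ℝ (V × W) (sndProj V W) = Module.finrank ℝ W := by
  simp [sndProj, LinearMap.trace_prodMap']

lemma lower_prodMetric_fstProj_apply (x u v : V × W) :
    lower (prodMetric G₁ G₂) (fstProj V W) x ![u, v] = G₁ x.1 u.1 v.1 := by
  simp [lower_apply, prodMetric_apply, fstProj]

lemma lower_prodMetric_sndProj_apply (x u v : V × W) :
    lower (prodMetric G₁ G₂) (sndProj V W) x ![u, v] = G₂ x.2 u.2 v.2 := by
  simp [lower_apply, prodMetric_apply, sndProj]

lemma prodMetric_apply_fstProj_add_sndProj (r₁ r₂ : ℝ) (x u v : V × W) :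
    prodMetric G₁ G₂ x u ((r₁ • fstProj V W + r₂ • sndProj V W) v) =
      prodMetric G₁ G₂ x ((r₁ • fstProj V W + r₂ • sndProj V W) u) v := by
  simp [prodMetric_apply, fstProj, sndProj]

lemma isParallel_lower_fstProj (h₁ : IsPseudoRiemannian G₁) (h₂ : IsPseudoRiemannian G₂) :
    IsParallel (prodMetric G₁ G₂) (lower (prodMetric G₁ G₂) (fstProj V W)) := by
  refine isParallel_lower (h₁.prodMetric h₂) fun x u v => ?_
  have h0 := h₂.christoffel_zero_right x.2 u.2
  simp [christoffel_prodMetric h₁ h₂, fstProj, h0]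

lemma isParallel_lower_sndProj (h₁ : IsPseudoRiemannian G₁) (h₂ : IsPseudoRiemannian G₂) :
    IsParallel (prodMetric G₁ G₂) (lower (prodMetric G₁ G₂) (sndProj V W)) := by
  refine isParallel_lower (h₁.prodMetric h₂) fun x u v => ?_
  have h0 := h₁.christoffel_zero_right x.1 u.1
  simp [christoffel_prodMetric h₁ h₂, sndProj, h0]

end Product

section ConstantCurvature

/-- Metrics of constant sectional curvature `c`. -/
def HasConstantCurvature {E : Type*} [NormedAddCommGroup E] [NormedSpace ℝ E] (G : BilinField E)
    (c : ℝ) : Prop :=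
  riem G = (c / 2) • kulkarniNomizu (metricTensor G) (metricTensor G)

variable {V W : Type*} [NormedAddCommGroup V] [NormedSpace ℝ V] [FiniteDimensional ℝ V]
  [NormedAddCommGroup W] [NormedSpace ℝ W] [FiniteDimensional ℝ W]
  {G₁ : BilinField V} {G₂ : BilinField W} {c₁ c₂ : ℝ}

local notation "d₁" => (Module.finrank ℝ V : ℝ)
local notation "d₂" => (Module.finrank ℝ W : ℝ)
local notation "π₁" => fstProj V W
local notation "π₂" => sndProj V W
local notation "G₁₂" => prodMetric G₁ G₂

lemma riem_prodMetric_of_hasConstantCurvature (h₁ : IsPseudoRiemannian G₁)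
    (h₂ : IsPseudoRiemannian G₂) (k₁ : HasConstantCurvature G₁ c₁)
    (k₂ : HasConstantCurvature G₂ c₂) :
    riem G₁₂ = (c₁ / 2) • kulkarniNomizu (lower G₁₂ π₁) (lower G₁₂ π₁) +
      (c₂ / 2) • kulkarniNomizu (lower G₁₂ π₂) (lower G₁₂ π₂) := by
  funext x v
  have : CompleteSpace V := FiniteDimensional.complete ℝ V
  have : CompleteSpace W := FiniteDimensional.complete ℝ W
  rw [riem_prodMetric h₁ h₂, k₁, k₂]
  simp only [Pi.add_apply, Pi.smul_apply, kulkarniNomizu, lower_prodMetric_fstProj_apply,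
    lower_prodMetric_sndProj_apply, metricTensor, Matrix.cons_val]

lemma ricci_prodMetric (h₁ : IsPseudoRiemannian G₁) (h₂ : IsPseudoRiemannian G₂)
    (k₁ : HasConstantCurvature G₁ c₁) (k₂ : HasConstantCurvature G₂ c₂) :
    ricci G₁₂ = lower G₁₂ (((d₁ - 1) * c₁) • π₁ + ((d₂ - 1) * c₂) • π₂) := by
  rw [ricci_eq_contract, riem_prodMetric_of_hasConstantCurvature h₁ h₂ k₁ k₂]
  simp only [contract_add, contract_smul, ← lower_smul, ← lower_add,
    (h₁.prodMetric h₂).contract_kulkarniNomizu_lower (C := 1) fun _ _ _ => rfl,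
    one_mul, mul_one, fstProj_mul_fstProj, sndProj_mul_sndProj, trace_fstProj, trace_sndProj]
  congr 1
  module

lemma scal_prodMetric (h₁ : IsPseudoRiemannian G₁) (h₂ : IsPseudoRiemannian G₂)
    (k₁ : HasConstantCurvature G₁ c₁) (k₂ : HasConstantCurvature G₂ c₂) (x : V × W) :
    scal G₁₂ x = d₁ * (d₁ - 1) * c₁ + d₂ * (d₂ - 1) * c₂ := by
  rw [scal, ricci_prodMetric h₁ h₂ k₁ k₂, (h₁.prodMetric h₂).metricTrace_lower]
  simp only [map_add, map_smul, trace_fstProj, trace_sndProj, smul_eq_mul]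
  ring

lemma weyl_prodMetric (h₁ : IsPseudoRiemannian G₁) (h₂ : IsPseudoRiemannian G₂)
    (k₁ : HasConstantCurvature G₁ c₁) (k₂ : HasConstantCurvature G₂ c₂) (hn : 2 < d₁ + d₂) :
    weyl G₁₂ = ((c₁ + c₂) / ((d₁ + d₂ - 1) * (d₁ + d₂ - 2))) •
      ((d₂ * (d₂ - 1) / 2) • kulkarniNomizu (lower G₁₂ π₁) (lower G₁₂ π₁)
        - ((d₁ - 1) * (d₂ - 1)) • kulkarniNomizu (lower G₁₂ π₁) (lower G₁₂ π₂)
        + (d₁ * (d₁ - 1) / 2) • kulkarniNomizu (lower G₁₂ π₂) (lower G₁₂ π₂)) := by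
  have hn0 : d₁ + d₂ ≠ 0 := by linarith
  have hn1 : d₁ + d₂ - 1 ≠ 0 := by linarith
  have hn2 : d₁ + d₂ - 2 ≠ 0 := by linarith
  have hg : metricTensor G₁₂ = lower G₁₂ π₁ + lower G₁₂ π₂ := by
    rw [← lower_one, ← fstProj_add_sndProj, lower_add]
  have hz : tracelessRicci G₁₂ = ricci G₁₂ -
      ((d₁ * (d₁ - 1) * c₁ + d₂ * (d₂ - 1) * c₂) / (d₁ + d₂)) • metricTensor G₁₂ := by
    funext x v
    simp [tracelessRicci, scal_prodMetric h₁ h₂ k₁ k₂, metricTensor]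
  funext x v
  simp only [weyl, hz, hg, ricci_prodMetric h₁ h₂ k₁ k₂, scal_prodMetric h₁ h₂ k₁ k₂,
    riem_prodMetric_of_hasConstantCurvature h₁ h₂ k₁ k₂, lower_add, lower_smul, kulkarniNomizu,
    Pi.add_apply, Pi.sub_apply, Pi.smul_apply, smul_eq_mul, Module.finrank_prod, Nat.cast_add]
  field_simp
  ring

lemma isParallel_weyl_prodMetric (h₁ : IsPseudoRiemannian G₁) (h₂ : IsPseudoRiemannian G₂)
    (k₁ : HasConstantCurvature G₁ c₁) (k₂ : HasConstantCurvature G₂ c₂) (hn : 2 < d₁ + d₂) :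
    IsParallel G₁₂ (weyl G₁₂) := by
  have hπ₁ : IsParallel G₁₂ (lower G₁₂ π₁) := isParallel_lower_fstProj h₁ h₂
  have hπ₂ : IsParallel G₁₂ (lower G₁₂ π₂) := isParallel_lower_sndProj h₁ h₂
  rw [weyl_prodMetric h₁ h₂ k₁ k₂ hn]
  exact ((((hπ₁.kulkarniNomizu hπ₁).const_smul _).sub ((hπ₁.kulkarniNomizu hπ₂).const_smul _)).add
    ((hπ₂.kulkarniNomizu hπ₂).const_smul _)).const_smul _

lemma bach_prodMetric (h₁ : IsPseudoRiemannian G₁) (h₂ : IsPseudoRiemannian G₂)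
    (k₁ : HasConstantCurvature G₁ c₁) (k₂ : HasConstantCurvature G₂ c₂) (hn : 2 < d₁ + d₂) :
    bach G₁₂ = ((c₁ + c₂) * (d₁ - 1) * (d₂ - 1) * ((d₁ - 1) * c₁ - (d₂ - 1) * c₂)
        / ((d₁ + d₂ - 1) * (d₁ + d₂ - 2) ^ 2)) •
      (d₂ • lower G₁₂ π₁ - d₁ • lower G₁₂ π₂) := by
  have hn1 : d₁ + d₂ - 1 ≠ 0 := by linarith
  have hn2 : d₁ + d₂ - 2 ≠ 0 := by linarith
  have hlin (x u a v : V × W) : IsLinearMap ℝ fun b => weyl G₁₂ x ![u, a, v, b] := by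
    rw [weyl_prodMetric h₁ h₂ k₁ k₂ hn]
    constructor
    · intro b b'
      simp [kulkarniNomizu, lower]
      ring
    · intro r b
      simp [kulkarniNomizu, lower]
      ring
  rw [bach_eq_smul_weylRicci (isParallel_weyl_prodMetric h₁ h₂ k₁ k₂ hn),
    (h₁.prodMetric h₂).weylRicci_eq_contract (ricci_prodMetric h₁ h₂ k₁ k₂) hlin,
    weyl_prodMetric h₁ h₂ k₁ k₂ hn]
  simp only [contract_add, contract_sub, contract_smul, ← lower_smul, ← lower_add, ← lower_sub,
    (h₁.prodMetric h₂).contract_kulkarniNomizu_lower (prodMetric_apply_fstProj_add_sndProj _ _),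
    add_mul, mul_add, smul_mul_assoc, mul_smul_comm, fstProj_mul_fstProj, fstProj_mul_sndProj,
    sndProj_mul_fstProj, sndProj_mul_sndProj, smul_zero, zero_add, add_zero, map_smul,
    trace_fstProj, trace_sndProj, smul_eq_mul, Module.finrank_prod, Nat.cast_add]
  congr 1
  match_scalars <;> field_simp <;> ring

lemma isParallel_bach_prodMetric (h₁ : IsPseudoRiemannian G₁) (h₂ : IsPseudoRiemannian G₂)
    (k₁ : HasConstantCurvature G₁ c₁) (k₂ : HasConstantCurvature G₂ c₂) (hn : 2 < d₁ + d₂) :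
    IsParallel G₁₂ (bach G₁₂) := by
  rw [bach_prodMetric h₁ h₂ k₁ k₂ hn]
  exact (((isParallel_lower_fstProj h₁ h₂).const_smul _).sub
    ((isParallel_lower_sndProj h₁ h₂).const_smul _)).const_smul _

lemma exists_bach_prodMetric_ne_zero (h₁ : IsPseudoRiemannian G₁) (h₂ : IsPseudoRiemannian G₂)
    (k₁ : HasConstantCurvature G₁ c₁) (k₂ : HasConstantCurvature G₂ c₂) (hd₁ : 1 < d₁)
    (hd₂ : 1 < d₂) (hc : c₁ + c₂ ≠ 0) (hne : (d₁ - 1) * c₁ ≠ (d₂ - 1) * c₂) (x : V × W) :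
    ∃ u v : V × W, bach G₁₂ x ![u, v] ≠ 0 := by
  have hpos : 0 < Module.finrank ℝ V := by exact_mod_cast one_pos.trans hd₁
  have : Nontrivial V := Module.nontrivial_of_finrank_pos hpos
  obtain ⟨e, he⟩ := h₁.isInvertible x.1
  obtain ⟨u, hu⟩ := exists_ne (0 : V)
  obtain ⟨v, hv⟩ : ∃ v, G₁ x.1 u v ≠ 0 := by
    by_contra! h
    exact hu (e.injective (by ext v; simpa [← he] using h v))
  refine ⟨(u, 0), (v, 0), ?_⟩
  have hn1 : d₁ + d₂ - 1 ≠ 0 := by linarith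
  have hn2 : d₁ + d₂ - 2 ≠ 0 := by linarith
  simp only [bach_prodMetric h₁ h₂ k₁ k₂ (by linarith), Pi.smul_apply, Pi.sub_apply,
    lower_prodMetric_fstProj_apply, lower_prodMetric_sndProj_apply, map_zero, smul_eq_mul,
    mul_zero, sub_zero]
  refine mul_ne_zero (div_ne_zero ?_ (by positivity)) (mul_ne_zero (by positivity) hv)
  exact mul_ne_zero (mul_ne_zero (mul_ne_zero hc (by linarith)) (by linarith)) (sub_ne_zero.2 hne)

end ConstantCurvature

section StaticPotential

lemma hessian_apply {E : Type*} [NormedAddCommGroup E] [NormedSpace ℝ E] (G : BilinField E)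
    (f : E → ℝ) (x u v : E) : hessian G f x ![u, v] =
      fderiv ℝ (fun y => fderiv ℝ f y v) x u - fderiv ℝ f x (christoffel G x u v) := by
  have h : covDeriv G (k := 0) (fun x _ => f x) = fun y w => fderiv ℝ f y (w 0) := by
    funext y w
    simp [covDeriv]
  rw [hessian, h, covDeriv]
  simp [Fin.tail]

variable {V W : Type*} [NormedAddCommGroup V] [NormedSpace ℝ V]
  [NormedAddCommGroup W] [NormedSpace ℝ W] {G₁ : BilinField V} {G₂ : BilinField W}

lemma hessian_prodMetric_comp_fst (h₁ : IsPseudoRiemannian G₁) (h₂ : IsPseudoRiemannian G₂)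
    {f : V → ℝ} (hf : ContDiff ℝ 2 f) (x u v : V × W) :
    hessian (prodMetric G₁ G₂) (fun y => f y.1) x ![u, v] = hessian G₁ f x.1 ![u.1, v.1] := by
  have hd : Differentiable ℝ f := hf.differentiable two_ne_zero
  have hd' : Differentiable ℝ fun y => fderiv ℝ f y v.1 :=
    ((hf.fderiv_right (m := 1) le_rfl).differentiable one_ne_zero).clm_apply
      (differentiable_const _)
  simp only [hessian_apply, christoffel_prodMetric h₁ h₂, fderiv_comp_fst (hd _),
    fderiv_comp_fst (f := fun y => fderiv ℝ f y v.1) (hd' _)]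

/-- The equation `Ddf = - c f g`, satisfied on the round sphere of curvature `c` by the
restrictions of linear functions. -/
def SolvesObata (G : BilinField V) (c : ℝ) (f : V → ℝ) : Prop :=
  ∀ x u v, hessian G f x ![u, v] = -(c * f x) * G x u v

variable [FiniteDimensional ℝ V] [FiniteDimensional ℝ W] {c₁ c₂ : ℝ}

local notation "d₁" => (Module.finrank ℝ V : ℝ)
local notation "d₂" => (Module.finrank ℝ W : ℝ)
local notation "G₁₂" => prodMetric G₁ G₂

lemma laplacian_prodMetric_comp_fst (h₁ : IsPseudoRiemannian G₁) (h₂ : IsPseudoRiemannian G₂)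
    {f : V → ℝ} (hf : ContDiff ℝ 2 f) (hO : SolvesObata G₁ c₁ f) (x : V × W) :
    laplacian G₁₂ (fun y => f y.1) x = -(d₁ * c₁) * f x.1 := by
  have h : (fun u v => hessian G₁₂ (fun y => f y.1) x ![u, v]) =
      fun u v => -(c₁ * f x.1) * lower G₁₂ (fstProj V W) x ![u, v] := by
    funext u v
    rw [hessian_prodMetric_comp_fst h₁ h₂ hf, hO, lower_prodMetric_fstProj_apply]
  rw [laplacian, h, metricTrace_const_mul, (h₁.prodMetric h₂).metricTrace_lower, trace_fstProj]
  ring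

lemma scal_prodMetric_div (h₁ : IsPseudoRiemannian G₁) (h₂ : IsPseudoRiemannian G₂)
    (k₁ : HasConstantCurvature G₁ c₁) (k₂ : HasConstantCurvature G₂ c₂) (hn : 1 < d₁ + d₂)
    (hc : (d₂ - 1) * c₂ = d₁ * c₁) (x : V × W) :
    scal G₁₂ x / ((Module.finrank ℝ (V × W) : ℝ) - 1) = d₁ * c₁ := by
  have hn1 : d₁ + d₂ - 1 ≠ 0 := by linarith
  rw [scal_prodMetric h₁ h₂ k₁ k₂, Module.finrank_prod, Nat.cast_add, div_eq_iff hn1]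
  linear_combination d₂ * hc

/-- The Ricci curvature of the second factor is `s / (n - 1)`, so the static equations only
constrain `f` along the first factor, where they reduce to Obata's equation. -/
lemma hessian_prodMetric_comp_fst_eq (h₁ : IsPseudoRiemannian G₁) (h₂ : IsPseudoRiemannian G₂)
    (k₁ : HasConstantCurvature G₁ c₁) (k₂ : HasConstantCurvature G₂ c₂)
    (hc : (d₂ - 1) * c₂ = d₁ * c₁) {f : V → ℝ} (hf : ContDiff ℝ 2 f)
    (hO : SolvesObata G₁ c₁ f) (x u v : V × W) :
    hessian G₁₂ (fun y => f y.1) x ![u, v] =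
      (ricci G₁₂ x ![u, v] - d₁ * c₁ * G₁₂ x u v) * f x.1 := by
  rw [hessian_prodMetric_comp_fst h₁ h₂ hf, hO, ricci_prodMetric h₁ h₂ k₁ k₂, prodMetric_apply]
  simp only [lower_add, lower_smul, Pi.add_apply, Pi.smul_apply, smul_eq_mul,
    lower_prodMetric_fstProj_apply, lower_prodMetric_sndProj_apply]
  linear_combination -(f x.1 * G₂ x.2 u.2 v.2) * hc

end StaticPotential

section RoundMetric

variable {V : Type*} [NormedAddCommGroup V] [InnerProductSpace ℝ V]

/-- The factor `2 / (‖y‖² + 4)` of inverse stereographic projection: with Mathlib's normalization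
the Euclidean metric of the sphere is `4 σ² ⟨·, ·⟩` in stereographic coordinates. -/
def stereoFactor (y : V) : ℝ := 2 / (‖y‖ ^ 2 + 4)

/-- The metric of constant curvature `c` in stereographic coordinates. -/
def roundMetric (V : Type*) [NormedAddCommGroup V] [InnerProductSpace ℝ V] (c : ℝ) :
    BilinField V :=
  fun y => (4 / c * stereoFactor y ^ 2) • innerSL ℝ

lemma roundMetric_apply (c : ℝ) (y u v : V) :
    roundMetric V c y u v = 4 / c * stereoFactor y ^ 2 * inner ℝ u v := rfl

omit [InnerProductSpace ℝ V] in
lemma stereoFactor_pos (y : V) : 0 < stereoFactor y := by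
  unfold stereoFactor; positivity

lemma stereoFactor_mul_inner_self (y : V) :
    stereoFactor y * inner ℝ y y = 2 - 4 * stereoFactor y := by
  rw [real_inner_self_eq_norm_sq, stereoFactor]
  field_simp
  ring

lemma hasFDerivAt_stereoFactor (y : V) :
    HasFDerivAt stereoFactor (-(stereoFactor y ^ 2) • innerSL ℝ y) y := by
  have h0 : ‖y‖ ^ 2 + 4 ≠ 0 := by positivity
  have h : HasFDerivAt (fun y : V => ‖y‖ ^ 2 + 4) (2 • innerSL ℝ y) y :=
    (hasStrictFDerivAt_norm_sq y).hasFDerivAt.add_const 4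
  refine (((hasDerivAt_inv h0).comp_hasFDerivAt y h).const_mul 2).congr_fderiv ?_
  ext u
  simp only [smul_apply, stereoFactor, smul_eq_mul, nsmul_eq_mul]
  field_simp
  norm_num

lemma contDiff_stereoFactor {n : WithTop ℕ∞} : ContDiff ℝ n (stereoFactor (V := V)) :=
  contDiff_const.div ((contDiff_norm_sq ℝ).add contDiff_const) fun y => by positivity

set_option maxSynthPendingDepth 3 in
lemma isPseudoRiemannian_roundMetric [CompleteSpace V] {c : ℝ} (hc : c ≠ 0) :
    IsPseudoRiemannian (roundMetric V c) where
  contDiff := (contDiff_const.mul (contDiff_stereoFactor.pow 2)).smul contDiff_const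
  symm x u v := by simp only [roundMetric_apply, real_inner_comm]
  isInvertible x := by
    have h : 4 / c * stereoFactor x ^ 2 ≠ 0 :=
      mul_ne_zero (div_ne_zero four_ne_zero hc) (pow_ne_zero 2 (stereoFactor_pos x).ne')
    exact ⟨(InnerProductSpace.toDual ℝ V).toContinuousLinearEquiv.trans
      (ContinuousLinearEquiv.smulLeft (Units.mk0 _ h)), rfl⟩

/-- The Christoffel symbols of the round metrics in stereographic coordinates. -/
def roundChristoffel (y u v : V) : V :=
  -stereoFactor y • ((inner ℝ y u : ℝ) • v + (inner ℝ y v : ℝ) • u - (inner ℝ u v : ℝ) • y)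

lemma fderiv_roundMetric [CompleteSpace V] {c : ℝ} (hc : c ≠ 0) (y u v w : V) :
    fderiv ℝ (roundMetric V c) y u v w =
      -(8 / c * stereoFactor y ^ 3) * inner ℝ y u * inner ℝ v w := by
  rw [(isPseudoRiemannian_roundMetric hc).fderiv_apply]
  refine (DFunLike.congr_fun ((((hasFDerivAt_stereoFactor y).pow 2).const_mul
    (4 / c)).mul_const (inner ℝ v w)).fderiv u).trans ?_
  simp only [smul_apply, innerSL_apply_apply, smul_eq_mul]
  ring

lemma christoffel_roundMetric [CompleteSpace V] {c : ℝ} (hc : c ≠ 0) (y u v : V) :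
    christoffel (roundMetric V c) y u v = roundChristoffel y u v := by
  refine (isPseudoRiemannian_roundMetric hc).christoffel_eq_iff.2 fun w => ?_
  simp only [fderiv_roundMetric hc, roundMetric_apply, roundChristoffel, inner_add_left,
    inner_sub_left, inner_smul_left, RCLike.conj_to_real]
  ring

lemma hasFDerivAt_inner_left (v y : V) :
    HasFDerivAt (fun y : V => (inner ℝ y v : ℝ)) (innerSL ℝ v) y :=
  (innerSL ℝ v).hasFDerivAt.congr_of_eventuallyEq (.of_forall fun z => real_inner_comm v z)

lemma hasFDerivAt_roundChristoffel (y v w : V) :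
    HasFDerivAt (fun y => roundChristoffel y v w)
      (-stereoFactor y • ((innerSL ℝ v).smulRight w + (innerSL ℝ w).smulRight v
          - (inner ℝ v w : ℝ) • ContinuousLinearMap.id ℝ V)
        + (stereoFactor y ^ 2 • innerSL ℝ y).smulRight
          ((inner ℝ y v : ℝ) • w + (inner ℝ y w : ℝ) • v - (inner ℝ v w : ℝ) • y)) y := by
  have h := (hasFDerivAt_stereoFactor y).neg.smul
    ((((hasFDerivAt_inner_left v y).smul_const w).add
      ((hasFDerivAt_inner_left w y).smul_const v)).sub
      ((hasFDerivAt_id y).const_smul (inner ℝ v w : ℝ)))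
  refine h.congr_fderiv ?_
  ext u
  simp

lemma curvOp_roundMetric [CompleteSpace V] {c : ℝ} (hc : c ≠ 0) (y u v w : V) :
    curvOp (roundMetric V c) y u v w =
      (4 * stereoFactor y ^ 2) • ((inner ℝ v w : ℝ) • u - (inner ℝ u w : ℝ) • v) := by
  simp only [curvOp, christoffel_roundMetric hc, (hasFDerivAt_roundChristoffel y _ _).fderiv]
  have h : stereoFactor y ^ 2 * inner ℝ y y = 2 * stereoFactor y - 4 * stereoFactor y ^ 2 := by
    linear_combination stereoFactor y * stereoFactor_mul_inner_self y
  simp only [roundChristoffel, inner_add_right, inner_sub_right, inner_smul_right, add_apply,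
    sub_apply, smul_apply, ContinuousLinearMap.smulRight_apply, innerSL_apply_apply, smul_eq_mul,
    ContinuousLinearMap.id_apply, real_inner_comm v u, real_inner_comm w u, real_inner_comm w v,
    real_inner_comm y u, real_inner_comm y v]
  linear_combination (norm := module) h • ((inner ℝ w u : ℝ) • v - (inner ℝ w v : ℝ) • u)

lemma hasConstantCurvature_roundMetric [CompleteSpace V] {c : ℝ} (hc : c ≠ 0) :
    HasConstantCurvature (roundMetric V c) c := by
  funext y v
  simp only [riem, curvOp_roundMetric hc, roundMetric_apply, inner_smul_left, inner_sub_left,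
    RCLike.conj_to_real, Pi.smul_apply, smul_eq_mul, kulkarniNomizu, metricTensor, Matrix.cons_val]
  field_simp
  ring

/-- The restriction of a linear function to the sphere, in stereographic coordinates: `t` is its
value at the pole and `l` its restriction to the equatorial hyperplane. -/
def stereoLinear (l : V →L[ℝ] ℝ) (t : ℝ) (y : V) : ℝ :=
  t + stereoFactor y * (2 * l y - 4 * t)

lemma contDiff_stereoLinear {n : WithTop ℕ∞} (l : V →L[ℝ] ℝ) (t : ℝ) :
    ContDiff ℝ n (stereoLinear l t) :=
  contDiff_const.add (contDiff_stereoFactor.mul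
    ((contDiff_const.mul l.contDiff).sub contDiff_const))

lemma hasFDerivAt_stereoLinear (l : V →L[ℝ] ℝ) (t : ℝ) (y : V) :
    HasFDerivAt (stereoLinear l t) ((2 * stereoFactor y) • l -
      (stereoFactor y ^ 2 * (2 * l y - 4 * t)) • innerSL ℝ y) y := by
  refine (((hasFDerivAt_stereoFactor y).mul
    ((l.hasFDerivAt.const_mul 2).sub_const (4 * t))).const_add t).congr_fderiv ?_
  module

lemma fderiv_fderiv_stereoLinear (l : V →L[ℝ] ℝ) (t : ℝ) (y u v : V) :
    fderiv ℝ (fun y => fderiv ℝ (stereoLinear l t) y v) y u =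
      -2 * stereoFactor y ^ 2 * (inner ℝ y u * l v + inner ℝ y v * l u)
        + (2 * l y - 4 * t) * (2 * stereoFactor y ^ 3 * inner ℝ y u * inner ℝ y v
          - stereoFactor y ^ 2 * inner ℝ u v) := by
  have hσ := hasFDerivAt_stereoFactor y
  have h := ((hσ.const_mul 2).mul_const (l v)).sub
    (((hσ.pow 2).mul ((l.hasFDerivAt.const_mul 2).sub_const (4 * t))).mul
      (hasFDerivAt_inner_left v y))
  simp only [(hasFDerivAt_stereoLinear l t _).fderiv]
  refine (DFunLike.congr_fun h.fderiv u).trans ?_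
  simp [real_inner_comm u v]
  ring

lemma solvesObata_stereoLinear [CompleteSpace V] {c : ℝ} (hc : c ≠ 0) (l : V →L[ℝ] ℝ) (t : ℝ) :
    SolvesObata (roundMetric V c) c (stereoLinear l t) := by
  intro y u v
  have h := stereoFactor_mul_inner_self y
  rw [hessian_apply, christoffel_roundMetric hc, fderiv_fderiv_stereoLinear,
    (hasFDerivAt_stereoLinear l t y).fderiv]
  simp only [roundChristoffel, sub_apply, smul_apply, smul_eq_mul, map_add, map_sub, map_smul,
    innerSL_apply_apply, roundMetric_apply, stereoLinear]
  field_simp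
  linear_combination (stereoFactor y ^ 2 * inner ℝ u v * (2 * l y - 4 * t)) * h

end RoundMetric

section Stereographic

variable {F : Type*} [NormedAddCommGroup F] [InnerProductSpace ℝ F]

lemma stereoInvFunAux_eq (v w : F) :
    stereoInvFunAux v w = v + stereoFactor w • ((2 : ℝ) • w - (4 : ℝ) • v) := by
  rw [stereoInvFunAux, stereoFactor]
  match_scalars <;> field_simp <;> ring

lemma hasFDerivAt_stereoInvFunAux_apply (v w : F) :
    HasFDerivAt (stereoInvFunAux v) ((2 * stereoFactor w) • ContinuousLinearMap.id ℝ F -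
      (stereoFactor w ^ 2 • innerSL ℝ w).smulRight ((2 : ℝ) • w - (4 : ℝ) • v)) w := by
  rw [funext (stereoInvFunAux_eq v)]
  refine (((hasFDerivAt_stereoFactor w).smul
    (((hasFDerivAt_id w).const_smul (2 : ℝ)).sub_const ((4 : ℝ) • v))).const_add v).congr_fderiv ?_
  ext u
  simp
  module

lemma inner_fderiv_stereoInvFunAux {v w u u' : F} (hv : ‖v‖ = 1) (hw : inner ℝ w v = 0)
    (hu : inner ℝ u v = 0) (hu' : inner ℝ u' v = 0) :
    inner ℝ (fderiv ℝ (stereoInvFunAux v) w u) (fderiv ℝ (stereoInvFunAux v) w u') =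
      4 * stereoFactor w ^ 2 * inner ℝ u u' := by
  have h := stereoFactor_mul_inner_self w
  have hv' : inner ℝ v v = (1 : ℝ) := inner_self_eq_one_of_norm_eq_one hv
  rw [(hasFDerivAt_stereoInvFunAux_apply v w).fderiv]
  simp only [sub_apply, smul_apply, ContinuousLinearMap.smulRight_apply, innerSL_apply_apply,
    ContinuousLinearMap.id_apply, inner_sub_left, inner_sub_right, inner_smul_left,
    inner_smul_right, RCLike.conj_to_real, hw, hu, hu', hv', real_inner_comm w v,
    real_inner_comm u' v, smul_eq_mul, real_inner_comm w u]
  linear_combination (4 * stereoFactor w ^ 3 * inner ℝ w u * inner ℝ w u') * h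

end Stereographic

section InducedMetric

lemma isVonNBounded_setOf_inner_lt_one {E F : Type*} [NormedAddCommGroup E] [NormedSpace ℝ E]
    [FiniteDimensional ℝ E] [NormedAddCommGroup F] [InnerProductSpace ℝ F] {L : E →L[ℝ] F}
    (hL : Function.Injective L) :
    Bornology.IsVonNBounded ℝ {v : E | inner ℝ (L v) (L v) < (1 : ℝ)} := by
  obtain ⟨K, -, hK⟩ := (L : E →ₗ[ℝ] F).exists_antilipschitzWith (LinearMap.ker_eq_bot.2 hL)
  rw [NormedSpace.isVonNBounded_iff]
  refine (hK.isBounded_preimage (Metric.isBounded_ball (x := 0) (r := 1))).subset fun v hv => ?_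
  simpa [real_inner_self_eq_norm_sq] using hv

variable {E : Type*} [NormedAddCommGroup E] [NormedSpace ℝ E]
  {H : Type*} [TopologicalSpace H] {I : ModelWithCorners ℝ E H}
  {M : Type*} [TopologicalSpace M] [ChartedSpace H M] [IsManifold I ∞ M]
  {F : Type*} [NormedAddCommGroup F] [InnerProductSpace ℝ F] {Φ : M → F}

variable (I) in
/-- The pullback of the inner product by a map into an inner product space. -/
def pullbackInner (Φ : M → F) (x : M) : TangentSpace I x →L[ℝ] TangentSpace I x →L[ℝ] ℝ :=
  (innerSL ℝ).bilinearComp (E := F) (F := F) (E' := E) (F' := E) (mfderiv I 𝓘(ℝ, F) Φ x)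
    (mfderiv I 𝓘(ℝ, F) Φ x)

variable [FiniteDimensional ℝ E]

lemma contMDiff_pullbackInner (hΦ : ContMDiff I 𝓘(ℝ, F) ∞ Φ) :
    ContMDiff I (I.prod 𝓘(ℝ, E →L[ℝ] E →L[ℝ] ℝ)) ∞
      (fun x : M => Bundle.TotalSpace.mk' (E →L[ℝ] E →L[ℝ] ℝ)
        (E := fun x => TangentSpace I x →L[ℝ] TangentSpace I x →L[ℝ] ℝ) x
        (pullbackInner I Φ x)) := by
  intro x₀
  rw [Bundle.contMDiffAt_section]
  have hD : ContMDiffAt I 𝓘(ℝ, E →L[ℝ] F) ∞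
      (inTangentCoordinates I 𝓘(ℝ, F) id Φ (fun x => mfderiv I 𝓘(ℝ, F) Φ x) x₀) x₀ :=
    (hΦ x₀).mfderiv_const (by simp)
  have hB : ContDiff ℝ ∞ fun D : E →L[ℝ] F => (innerSL ℝ).bilinearComp D D :=
    contDiff_clm_apply_iff.2 fun u => contDiff_clm_apply_iff.2 fun v =>
      (contDiff_id.clm_apply contDiff_const).inner ℝ (contDiff_id.clm_apply contDiff_const)
  refine (hB.contMDiff.contMDiffAt.comp x₀ hD).congr_of_eventuallyEq ?_
  filter_upwards [(chartAt H x₀).open_source.mem_nhds (mem_chart_source H x₀)] with x hx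
  have hx' : x ∈ (trivializationAt (E →L[ℝ] ℝ) (fun x => TangentSpace I x →L[ℝ] ℝ) x₀).baseSet := by
    simp [hom_trivializationAt_baseSet, hx]
  ext v w
  simp only [pullbackInner, hom_trivializationAt_apply, ContinuousLinearMap.inCoordinates,
    ContinuousLinearMap.comp_apply, Bundle.Trivialization.continuousLinearMapAt_apply,
    Function.comp_apply, inTangentCoordinates, TangentBundle.continuousLinearMapAt_model_space,
    id_eq, ContinuousLinearMap.bilinearComp_apply, coe_innerSL_apply]
  rw [Bundle.Trivialization.linearMapAt_apply, if_pos hx', hom_trivializationAt_apply]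
  simp only [ContinuousLinearMap.inCoordinates, Bundle.Trivial.fiberBundle_trivializationAt',
    Bundle.Trivial.continuousLinearMapAt_trivialization, ContinuousLinearMap.id_comp,
    ContinuousLinearMap.comp_apply]
  rfl

/-- The Riemannian metric induced by an immersion in an inner product space. -/
def inducedMetric (hΦ : ContMDiff I 𝓘(ℝ, F) ∞ Φ)
    (hinj : ∀ x, Function.Injective (mfderiv I 𝓘(ℝ, F) Φ x)) : RMetric I M where
  inner := pullbackInner I Φ
  symm _ _ _ := real_inner_comm (F := F) _ _
  pos x _ hv := real_inner_self_pos (F := F).2 fun h => hv (hinj x (h.trans (map_zero _).symm))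
  isVonNBounded x := isVonNBounded_setOf_inner_lt_one (E := E) (hinj x)
  contMDiff := contMDiff_pullbackInner hΦ

lemma inducedMetric_apply (hΦ : ContMDiff I 𝓘(ℝ, F) ∞ Φ)
    (hinj : ∀ x, Function.Injective (mfderiv I 𝓘(ℝ, F) Φ x)) (x : M) (u v : TangentSpace I x) :
    (inducedMetric hΦ hinj).inner x u v =
      inner ℝ (E := F) (mfderiv I 𝓘(ℝ, F) Φ x u) (mfderiv I 𝓘(ℝ, F) Φ x v) := rfl

lemma chartMetric_inducedMetric [I.Boundaryless] (hΦ : ContMDiff I 𝓘(ℝ, F) ∞ Φ)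
    (hinj : ∀ x, Function.Injective (mfderiv I 𝓘(ℝ, F) Φ x)) {x : M} {y : E}
    (hy : y ∈ (extChartAt I x).target) (u v : E) :
    chartMetric (inducedMetric hΦ hinj) x y u v =
      inner ℝ (fderiv ℝ (Φ ∘ (extChartAt I x).symm) y u)
        (fderiv ℝ (Φ ∘ (extChartAt I x).symm) y v) := by
  have hφ : MDifferentiableAt 𝓘(ℝ, E) I (extChartAt I x).symm y := by
    simpa only [ModelWithCorners.range_eq_univ, mdifferentiableWithinAt_univ] using
      mdifferentiableWithinAt_extChartAt_symm hy
  rw [← mfderiv_eq_fderiv, mfderiv_comp y (hΦ.mdifferentiableAt (by simp)) hφ]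
  rfl

end InducedMetric

section Complete

variable {E : Type*} [NormedAddCommGroup E] [NormedSpace ℝ E]
  {H : Type*} [TopologicalSpace H] {I : ModelWithCorners ℝ E H}
  {M : Type*} [TopologicalSpace M] [ChartedSpace H M] [IsManifold I ∞ M]

lemma isComplete_of_compactSpace [CompactSpace M] [T2Space M] (g : RMetric I M) :
    IsComplete g := by
  let _ : Bundle.RiemannianBundle (fun x : M => TangentSpace I x) := ⟨g.toRiemannianMetric⟩
  have : IsManifold I 1 M := IsManifold.of_le (n := ∞) (by simp)
  have : IsContinuousRiemannianBundle E (fun x : M => TangentSpace I x) :=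
    ⟨g.inner, g.contMDiff.continuous, fun _ _ _ => rfl⟩
  let _ : PseudoEMetricSpace M := PseudoEMetricSpace.ofRiemannianMetric I M
  intro u hu
  have hc : CauchySeq u := EMetric.cauchySeq_iff.2 fun ε hε => hu ε hε
  exact cauchySeq_tendsto_of_complete hc

end Complete

section ScaledProduct

variable {V W : Type*} [NormedAddCommGroup V] [NormedAddCommGroup W]

/-- The linear map `(v, w) ↦ (r₁ v, r₂ w)` into the `ℓ²` product. -/
def scaleProd [NormedSpace ℝ V] [NormedSpace ℝ W] (r₁ r₂ : ℝ) : V × W →L[ℝ] WithLp 2 (V × W) :=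
  (WithLp.prodContinuousLinearEquiv 2 ℝ V W).symm.toContinuousLinearMap.comp
    ((r₁ • ContinuousLinearMap.id ℝ V).prodMap (r₂ • ContinuousLinearMap.id ℝ W))

lemma fderiv_scaleProd_comp_prodMap [NormedSpace ℝ V] [NormedSpace ℝ W] {E F : Type*}
    [NormedAddCommGroup E] [NormedSpace ℝ E] [NormedAddCommGroup F] [NormedSpace ℝ F] (r₁ r₂ : ℝ)
    {f : E → V} {g : F → W} {y : E × F} (hf : DifferentiableAt ℝ f y.1)
    (hg : DifferentiableAt ℝ g y.2) (u : E × F) :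
    fderiv ℝ (scaleProd r₁ r₂ ∘ Prod.map f g) y u =
      scaleProd r₁ r₂ (fderiv ℝ f y.1 u.1, fderiv ℝ g y.2 u.2) :=
  DFunLike.congr_fun ((scaleProd r₁ r₂).hasFDerivAt.comp y
    (HasFDerivAt.prodMap y hf.hasFDerivAt hg.hasFDerivAt)).fderiv u

lemma mfderiv_scaleProd_comp_prodMap [NormedSpace ℝ V] [NormedSpace ℝ W]
    {E F H K M N : Type*} [NormedAddCommGroup E] [NormedSpace ℝ E] [NormedAddCommGroup F]
    [NormedSpace ℝ F] [TopologicalSpace H] [TopologicalSpace K] {I : ModelWithCorners ℝ E H}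
    {J : ModelWithCorners ℝ F K} [TopologicalSpace M] [ChartedSpace H M] [TopologicalSpace N]
    [ChartedSpace K N] (r₁ r₂ : ℝ) {f : M → V} {g : N → W} {x : M × N}
    (hf : MDifferentiableAt I 𝓘(ℝ, V) f x.1) (hg : MDifferentiableAt J 𝓘(ℝ, W) g x.2)
    (u : TangentSpace (I.prod J) x) :
    mfderiv (I.prod J) 𝓘(ℝ, WithLp 2 (V × W)) (scaleProd r₁ r₂ ∘ Prod.map f g) x u =
      scaleProd (V := V) (W := W) r₁ r₂
        (mfderiv I 𝓘(ℝ, V) f x.1 (Prod.fst u), mfderiv J 𝓘(ℝ, W) g x.2 (Prod.snd u)) := by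
  have h := hf.hasMFDerivAt.prodMap hg.hasMFDerivAt
  rw [← modelWithCornersSelf_prod (E := V), chartedSpaceSelf_prod] at h
  rw [((scaleProd (V := V) (W := W) r₁ r₂).hasMFDerivAt.comp x h).mfderiv]
  rfl

lemma inner_scaleProd [InnerProductSpace ℝ V] [InnerProductSpace ℝ W] (r₁ r₂ : ℝ)
    (u v : V × W) : inner ℝ (scaleProd r₁ r₂ u) (scaleProd r₁ r₂ v) =
      r₁ ^ 2 * inner ℝ u.1 v.1 + r₂ ^ 2 * inner ℝ u.2 v.2 := by
  change inner ℝ (r₁ • u.1) (r₁ • v.1) + inner ℝ (r₂ • u.2) (r₂ • v.2) = _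
  simp only [real_inner_smul_left, real_inner_smul_right]
  ring

lemma scaleProd_injective [NormedSpace ℝ V] [NormedSpace ℝ W] {r₁ r₂ : ℝ} (h₁ : r₁ ≠ 0)
    (h₂ : r₂ ≠ 0) : Function.Injective (scaleProd (V := V) (W := W) r₁ r₂) :=
  (WithLp.toLp_injective 2).comp
    ((smul_right_injective V h₁).prodMap (smul_right_injective W h₂))

end ScaledProduct

local notation "𝔼" n:max => EuclideanSpace ℝ (Fin n)

local instance {p : ℕ} : Fact (Module.finrank ℝ (𝔼 (p + 1)) = p + 1) := ⟨finrank_euclideanSpace_fin⟩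

section Sphere

variable {p q : ℕ}

lemma extChartAt_sphere_target (x : Sph p) : (extChartAt (𝓡 p) x).target = Set.univ := by
  have h : (chartAt (𝔼 p) x).target = Set.univ := stereographic'_target (-x)
  simp [h]

/-- The parametrization of the unit sphere, as a subset of Euclidean space, inverse to the
preferred chart at `x`. It is inverse stereographic projection from `-x`. -/
def sphereParam (x : Sph p) (y : 𝔼 p) : 𝔼 (p + 1) := (extChartAt (𝓡 p) x).symm y

lemma exists_sphereParam_eq (x : Sph p) : ∃ J : 𝔼 p →ₗᵢ[ℝ] 𝔼 (p + 1),
    (∀ y, inner ℝ (J y) (-x : 𝔼 (p + 1)) = 0) ∧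
      ∀ y, sphereParam x y = stereoInvFunAux (-x : 𝔼 (p + 1)) (J y) := by
  let U := (OrthonormalBasis.fromOrthogonalSpanSingleton (𝕜 := ℝ) p
    (ne_zero_of_mem_unit_sphere (-x))).repr
  refine ⟨(Submodule.subtypeₗᵢ _).comp U.symm.toLinearIsometry, fun y =>
    Submodule.mem_orthogonal_singleton_iff_inner_left.1 (U.symm y).2, fun y => ?_⟩
  exact (stereographic'_symm_apply (-x) y).trans (smul_add _ _ _).symm

lemma differentiable_sphereParam (x : Sph p) : Differentiable ℝ (sphereParam x) := by
  obtain ⟨J, -, hx⟩ := exists_sphereParam_eq x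
  rw [funext hx]
  exact ((contDiff_stereoInvFunAux (m := 1)).differentiable one_ne_zero).comp
    J.toContinuousLinearMap.differentiable

lemma inner_fderiv_sphereParam (x : Sph p) (y u v : 𝔼 p) :
    inner ℝ (fderiv ℝ (sphereParam x) y u) (fderiv ℝ (sphereParam x) y v) =
      4 * stereoFactor y ^ 2 * inner ℝ u v := by
  obtain ⟨J, hJ, hx⟩ := exists_sphereParam_eq x
  have hd (u : 𝔼 p) : fderiv ℝ (sphereParam x) y u =
      fderiv ℝ (stereoInvFunAux (-x : 𝔼 (p + 1))) (J y) (J u) := by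
    have h := ((contDiff_stereoInvFunAux (v := (-x : 𝔼 (p + 1))) (m := 1)).differentiable
      one_ne_zero (J y)).hasFDerivAt.comp y J.toContinuousLinearMap.hasFDerivAt
    rw [funext hx]
    exact DFunLike.congr_fun h.fderiv u
  rw [hd, hd, inner_fderiv_stereoInvFunAux (by simp) (hJ y) (hJ u) (hJ v),
    J.inner_map_map, stereoFactor, stereoFactor, J.norm_map]

lemma exists_inner_sphereParam_eq (x : Sph p) (e : EuclideanSpace ℝ (Fin (p + 1))) :
    ∃ l t, (fun y => inner ℝ (sphereParam x y) e) = stereoLinear l t := by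
  obtain ⟨J, -, hx⟩ := exists_sphereParam_eq x
  refine ⟨(innerSL ℝ e).comp J.toContinuousLinearMap, inner ℝ (-x : 𝔼 (p + 1)) e, ?_⟩
  funext y
  rw [hx, stereoInvFunAux_eq, stereoLinear, stereoFactor, stereoFactor, J.norm_map]
  simp only [inner_add_left, inner_sub_left, real_inner_smul_left, ContinuousLinearMap.comp_apply,
    coe_innerSL_apply, LinearIsometry.coe_toContinuousLinearMap, real_inner_comm e (J y)]

/-- The inclusion of `S^p × S^q` in Euclidean space as a product of spheres of radii `r₁`, `r₂`. -/
def spheresIncl (r₁ r₂ : ℝ) (z : Sph p × Sph q) : WithLp 2 (𝔼 (p + 1) × 𝔼 (q + 1)) :=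
  scaleProd r₁ r₂ (z.1, z.2)

lemma contMDiff_spheresIncl (r₁ r₂ : ℝ) : ContMDiff ((𝓡 p).prod (𝓡 q))
    𝓘(ℝ, WithLp 2 (𝔼 (p + 1) × 𝔼 (q + 1))) ∞ (spheresIncl (p := p) (q := q) r₁ r₂) := by
  have h := ((contMDiff_coe_sphere (m := ∞) (E := 𝔼 (p + 1)) (n := p)).comp
      (contMDiff_fst (I := 𝓡 p) (J := 𝓡 q) (N := Sph q))).prodMk_space
    ((contMDiff_coe_sphere (m := ∞) (E := 𝔼 (q + 1)) (n := q)).comp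
      (contMDiff_snd (I := 𝓡 p) (J := 𝓡 q) (M := Sph p)))
  exact (scaleProd r₁ r₂).contDiff.contMDiff.comp h

lemma mfderiv_spheresIncl (r₁ r₂ : ℝ) (x : Sph p × Sph q)
    (u : TangentSpace ((𝓡 p).prod (𝓡 q)) x) :
    mfderiv ((𝓡 p).prod (𝓡 q)) 𝓘(ℝ, WithLp 2 (𝔼 (p + 1) × 𝔼 (q + 1))) (spheresIncl r₁ r₂) x u =
      scaleProd r₁ r₂ (ambientVec x.1 (Prod.fst u), ambientVec x.2 (Prod.snd u)) :=
  mfderiv_scaleProd_comp_prodMap r₁ r₂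
    ((contMDiff_coe_sphere (m := 1)).mdifferentiableAt one_ne_zero)
    ((contMDiff_coe_sphere (m := 1)).mdifferentiableAt one_ne_zero) u

lemma ambientVec_injective (x : Sph p) : Function.Injective (ambientVec x) :=
  injective_mvfderiv_subtypeVal_sphere x

lemma mfderiv_spheresIncl_injective {r₁ r₂ : ℝ} (h₁ : r₁ ≠ 0) (h₂ : r₂ ≠ 0) (x : Sph p × Sph q) :
    Function.Injective (mfderiv ((𝓡 p).prod (𝓡 q)) 𝓘(ℝ, WithLp 2 (𝔼 (p + 1) × 𝔼 (q + 1)))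
      (spheresIncl r₁ r₂) x) := by
  intro u v h
  rw [mfderiv_spheresIncl, mfderiv_spheresIncl] at h
  have h' := Prod.ext_iff.1 (scaleProd_injective h₁ h₂ h)
  exact Prod.ext (ambientVec_injective x.1 h'.1) (ambientVec_injective x.2 h'.2)

variable {c₁ c₂ : ℝ}

variable (p q) in
/-- The Riemannian product `S^p(c₁) × S^q(c₂)` of round spheres. -/
def roundProduct (h₁ : 0 < c₁) (h₂ : 0 < c₂) :
    RMetric ((𝓡 p).prod (𝓡 q)) (Sph p × Sph q) :=
  inducedMetric (contMDiff_spheresIncl (√c₁)⁻¹ (√c₂)⁻¹)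
    (mfderiv_spheresIncl_injective (by positivity) (by positivity))

lemma isRoundProduct_roundProduct (h₁ : 0 < c₁) (h₂ : 0 < c₂) :
    IsRoundProduct c₁ c₂ (roundProduct p q h₁ h₂) := by
  intro x u v
  rw [roundProduct, inducedMetric_apply, mfderiv_spheresIncl, mfderiv_spheresIncl,
    inner_scaleProd, inv_pow, inv_pow, Real.sq_sqrt h₁.le, Real.sq_sqrt h₂.le,
    one_div, one_div]
  rfl

lemma spheresIncl_comp_extChartAt_symm (r₁ r₂ : ℝ) (x : Sph p × Sph q) :
    spheresIncl r₁ r₂ ∘ (extChartAt ((𝓡 p).prod (𝓡 q)) x).symm =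
      scaleProd r₁ r₂ ∘ Prod.map (sphereParam x.1) (sphereParam x.2) := by
  rw [extChartAt_prod]
  rfl

lemma chartMetric_roundProduct (h₁ : 0 < c₁) (h₂ : 0 < c₂) (x : Sph p × Sph q) :
    chartMetric (roundProduct p q h₁ h₂) x =
      prodMetric (roundMetric (𝔼 p) c₁) (roundMetric (𝔼 q) c₂) := by
  funext y
  refine ContinuousLinearMap.ext fun u => ContinuousLinearMap.ext fun v => ?_
  have hy : y ∈ (extChartAt ((𝓡 p).prod (𝓡 q)) x).target := by
    rw [extChartAt_prod, PartialEquiv.prod_target, extChartAt_sphere_target,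
      extChartAt_sphere_target, Set.univ_prod_univ]
    trivial
  rw [roundProduct, chartMetric_inducedMetric _ _ hy,
    spheresIncl_comp_extChartAt_symm,
    fderiv_scaleProd_comp_prodMap _ _ (differentiable_sphereParam _ _)
      (differentiable_sphereParam _ _),
    fderiv_scaleProd_comp_prodMap _ _ (differentiable_sphereParam _ _)
      (differentiable_sphereParam _ _), inner_scaleProd,
    inner_fderiv_sphereParam, inner_fderiv_sphereParam, prodMetric_apply, roundMetric_apply,
    roundMetric_apply, inv_pow, inv_pow, Real.sq_sqrt h₁.le, Real.sq_sqrt h₂.le]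
  ring

end Sphere

section SphereProduct

variable {p q : ℕ} {c₁ c₂ : ℝ}

/-- The height function `(z, w) ↦ ⟨z, e⟩` on `S^p × S^q`, the potential of the static equations. -/
def height (e : EuclideanSpace ℝ (Fin (p + 1))) (z : Sph p × Sph q) : ℝ :=
  inner ℝ (z.1 : 𝔼 (p + 1)) e

lemma contMDiff_height (e : EuclideanSpace ℝ (Fin (p + 1))) :
    ContMDiff ((𝓡 p).prod (𝓡 q)) 𝓘(ℝ, ℝ) ∞ (height (q := q) e) := by
  have h : ContDiff ℝ ∞ fun v : 𝔼 (p + 1) => inner ℝ v e := contDiff_id.inner ℝ contDiff_const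
  exact h.contMDiff.comp (contMDiff_coe_sphere.comp contMDiff_fst)

lemma exists_height_comp_extChartAt_symm_eq (e : EuclideanSpace ℝ (Fin (p + 1)))
    (x : Sph p × Sph q) :
    ∃ l t, height e ∘ (extChartAt ((𝓡 p).prod (𝓡 q)) x).symm =
      fun y => stereoLinear l t y.1 := by
  obtain ⟨l, t, hl⟩ := exists_inner_sphereParam_eq x.1 e
  refine ⟨l, t, funext fun y => ?_⟩
  rw [← congrFun hl y.1, extChartAt_prod]
  rfl

lemma solvesVacuumStatic_roundProduct (h₁ : 0 < c₁) (h₂ : 0 < c₂) (hn : 1 < p + q)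
    (hc : ((q : ℝ) - 1) * c₂ = p * c₁) (e : EuclideanSpace ℝ (Fin (p + 1))) :
    SolvesVacuumStatic (roundProduct p q h₁ h₂) (height e) := by
  intro x G F y n
  obtain ⟨l, t, hF⟩ := exists_height_comp_extChartAt_symm_eq e x
  have hx : height e x = stereoLinear l t y.1 := by
    rw [← congrFun hF y, Function.comp_apply, extChartAt_to_inv]
  have g₁ := isPseudoRiemannian_roundMetric (V := 𝔼 p) h₁.ne'
  have g₂ := isPseudoRiemannian_roundMetric (V := 𝔼 q) h₂.ne'
  have k₁ := hasConstantCurvature_roundMetric (V := 𝔼 p) h₁.ne'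
  have k₂ := hasConstantCurvature_roundMetric (V := 𝔼 q) h₂.ne'
  have hO := solvesObata_stereoLinear (V := 𝔼 p) h₁.ne' l t
  rw [← finrank_euclideanSpace_fin (𝕜 := ℝ) (n := p),
    ← finrank_euclideanSpace_fin (𝕜 := ℝ) (n := q)] at hc
  have hs := scal_prodMetric_div g₁ g₂ k₁ k₂
    (by rw [finrank_euclideanSpace_fin, finrank_euclideanSpace_fin]; exact_mod_cast hn) hc y
  simp only [G, F, n, chartMetric_roundProduct, hF, hx, hs]
  exact ⟨laplacian_prodMetric_comp_fst g₁ g₂ (contDiff_stereoLinear l t) hO y, fun u v =>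
    sub_eq_zero.2 (hessian_prodMetric_comp_fst_eq g₁ g₂ k₁ k₂ hc (contDiff_stereoLinear l t) hO
      y u v)⟩

instance : Nonempty (Sph p) :=
  (NormedSpace.sphere_nonempty.2 zero_le_one).to_subtype

lemma isVacuumStatic_roundProduct (h₁ : 0 < c₁) (h₂ : 0 < c₂) (hn : 1 < p + q)
    (hc : ((q : ℝ) - 1) * c₂ = p * c₁) : IsVacuumStatic (roundProduct p q h₁ h₂) := by
  obtain ⟨x⟩ : Nonempty (Sph p × Sph q) := inferInstance
  refine ⟨isComplete_of_compactSpace _, height x.1, contMDiff_height _, ⟨x, ?_⟩,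
    solvesVacuumStatic_roundProduct h₁ h₂ hn hc _⟩
  simp [height]

lemma isExample_roundProduct (h₁ : 0 < c₁) (h₂ : 0 < c₂) (hp : 2 ≤ p) (hq : 2 ≤ q)
    (hc : ((q : ℝ) - 1) * c₂ = p * c₁) : IsExample (roundProduct p q h₁ h₂) := by
  have g₁ := isPseudoRiemannian_roundMetric (V := 𝔼 p) h₁.ne'
  have g₂ := isPseudoRiemannian_roundMetric (V := 𝔼 q) h₂.ne'
  have k₁ := hasConstantCurvature_roundMetric (V := 𝔼 p) h₁.ne'
  have k₂ := hasConstantCurvature_roundMetric (V := 𝔼 q) h₂.ne'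
  have hp' : (2 : ℝ) ≤ Module.finrank ℝ (𝔼 p) := by simpa using hp
  have hq' : (2 : ℝ) ≤ Module.finrank ℝ (𝔼 q) := by simpa using hq
  have hne : ((Module.finrank ℝ (𝔼 p) : ℝ) - 1) * c₁ ≠
      ((Module.finrank ℝ (𝔼 q) : ℝ) - 1) * c₂ := by
    simp only [finrank_euclideanSpace_fin, hc]
    linarith
  obtain ⟨x⟩ : Nonempty (Sph p × Sph q) := inferInstance
  refine ⟨isVacuumStatic_roundProduct h₁ h₂ (by omega) hc, fun x => ?_, fun x => ?_, fun h => ?_⟩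
  · rw [chartMetric_roundProduct]
    exact div2Bach_eq_zero (isParallel_bach_prodMetric g₁ g₂ k₁ k₂ (by linarith)) _
  · rw [chartMetric_roundProduct]
    exact div4Weyl_eq_zero (isParallel_weyl_prodMetric g₁ g₂ k₁ k₂ (by linarith)) _
  · obtain ⟨u, v, huv⟩ := exists_bach_prodMetric_ne_zero g₁ g₂ k₁ k₂ (by linarith) (by linarith)
      (by positivity) hne (extChartAt ((𝓡 p).prod (𝓡 q)) x x)
    rw [← chartMetric_roundProduct h₁ h₂ x] at huv
    exact huv (h x u v)

lemma exists_isRoundProduct_isExample (h₁ : 0 < c₁) (h₂ : 0 < c₂) (hp : 2 ≤ p) (hq : 2 ≤ q)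
    (hc : ((q : ℝ) - 1) * c₂ = p * c₁) :
    ∃ g : RMetric ((𝓡 p).prod (𝓡 q)) (Sph p × Sph q), IsRoundProduct c₁ c₂ g ∧ IsExample g :=
  ⟨roundProduct p q h₁ h₂, isRoundProduct_roundProduct h₁ h₂,
    isExample_roundProduct h₁ h₂ hp hq hc⟩

lemma connectedSpace_sph (hp : 1 ≤ p) : ConnectedSpace (Sph p) := by
  refine isConnected_iff_connectedSpace.1 (isConnected_sphere ?_ _ zero_le_one)
  rw [← Module.finrank_eq_rank, finrank_euclideanSpace_fin]
  exact_mod_cast Nat.lt_add_of_pos_left hp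

lemma exists_isExample_finrank_eq {n : ℕ} (hn : 4 ≤ n) :
    ∃ (E : Type) (_ : NormedAddCommGroup E) (_ : NormedSpace ℝ E) (_ : FiniteDimensional ℝ E)
      (H : Type) (_ : TopologicalSpace H) (I : ModelWithCorners ℝ E H)
      (M : Type) (_ : TopologicalSpace M) (_ : ChartedSpace H M) (_ : IsManifold I ∞ M)
      (g : RMetric I M),
      I.Boundaryless ∧ T2Space M ∧ SecondCountableTopology M ∧ ConnectedSpace M ∧
        Module.finrank ℝ E = n ∧ IsExample g := by
  obtain ⟨q, rfl⟩ := Nat.exists_eq_add_of_le' (show 2 ≤ n by omega)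
  have hq : 2 ≤ q := by omega
  have hq' : 0 < (q : ℝ) - 1 := sub_pos.2 (by exact_mod_cast hq)
  have := connectedSpace_sph (p := 2) (by norm_num)
  have := connectedSpace_sph (one_le_two.trans hq)
  exact ⟨_, _, _, inferInstance, _, _, (𝓡 2).prod (𝓡 q), Sph 2 × Sph q, _, _, _,
    roundProduct 2 q hq' two_pos, inferInstance, inferInstance, inferInstance, inferInstance,
    by simp [add_comm], isExample_roundProduct hq' two_pos le_rfl hq (by push_cast; ring)⟩

end SphereProduct

end StaticSpace

end

theorem proposition2p5 :
    -- existence in every dimension `n ≥ 4`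
    (∀ n : ℕ, 4 ≤ n →
      ∃ (E : Type) (_ : NormedAddCommGroup E) (_ : NormedSpace ℝ E) (_ : FiniteDimensional ℝ E)
        (H : Type) (_ : TopologicalSpace H) (I : ModelWithCorners ℝ E H)
        (M : Type) (_ : TopologicalSpace M) (_ : ChartedSpace H M) (_ : IsManifold I ∞ M)
        (g : StaticSpace.RMetric I M),
        I.Boundaryless ∧ T2Space M ∧ SecondCountableTopology M ∧ ConnectedSpace M ∧
          Module.finrank ℝ E = n ∧ StaticSpace.IsExample g) ∧
    -- dimension `2m`: the product `S^m(a / (k l)) × S^m(a / l)` with `k = m / (m - 1)` and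
    -- `l = 3 m (m - 1) / 2`
    (∀ m : ℕ, 2 ≤ m → ∀ a : ℝ, 0 < a →
      ∃ g : StaticSpace.RMetric ((𝓡 m).prod (𝓡 m)) (StaticSpace.Sph m × StaticSpace.Sph m),
        StaticSpace.IsRoundProduct
          (a / (((m : ℝ) / ((m : ℝ) - 1)) * (3 * (m : ℝ) * ((m : ℝ) - 1) / 2)))
          (a / (3 * (m : ℝ) * ((m : ℝ) - 1) / 2)) g ∧
        StaticSpace.IsExample g) ∧
    -- dimension `2m + 1`: the product `S^m × S^(m+1)` of unit spheres
    (∀ m : ℕ, 2 ≤ m →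
      ∃ g : StaticSpace.RMetric ((𝓡 m).prod (𝓡 (m + 1)))
          (StaticSpace.Sph m × StaticSpace.Sph (m + 1)),
        StaticSpace.IsRoundProduct 1 1 g ∧ StaticSpace.IsExample g) := by
  refine ⟨fun n hn => StaticSpace.exists_isExample_finrank_eq hn, fun m hm a ha => ?_,
    fun m hm => ?_⟩
  · have hm' : 0 < (m : ℝ) - 1 := sub_pos.2 (by exact_mod_cast hm)
    exact StaticSpace.exists_isRoundProduct_isExample (by positivity) (by positivity) hm hm
      (by field_simp)
  · exact StaticSpace.exists_isRoundProduct_isExample one_pos one_pos hm (by omega)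
      (by push_cast; ring)
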